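/- Let $p$ be a prime number, let $R$ be a discrete valuation domain of characteristic $0$ with maximal ideal $pR$, and let $G$ be a cyclic group of order $p^n$, $n\geq 0$. Consider the category of cohomological $G$-Mackey functors with values in $R$-modules, i.e. families of $R$-modules $(\mathbf X_U)_{U\le G}$ with restriction maps $i_{U,V}\colon \mathbf X_U\to\mathbf X_V$, transfer maps $t_{V,U}\colon\mathbf X_V\to\mathbf X_U$ $(V\le U)$ and conjugation maps $c_{g,U}\colon \mathbf X_U\to\mathbf X_{gUg^{-1}}$ satisfying the usual Mackey axioms and $t_{V,U}\circ i_{U,V}=|U:V|\cdot\mathrm{id}$. For an $R[G]$-module $M$ let $\mathbf h^0(M)$ be the fixed point functor, $\mathbf h^0(M)_U=M^U$, where $i$ is inclusion, $t_{V,U}=\sum_{r\in U/V}r$ and $c_{g,U}$ is multiplication by $g$; for $W\le G$ put $\mathbf P^W=\mathbf h^0(R[G/W])$, so that $\mathbf P^W_U=R[G/W]^U\cong\mathrm{Hom}_{R[G]}(R[G/U],R[G/W])$. A projective $R$-lattice functor is a projective object $\mathbf P$ of this category such that every $\mathbf P_U$ is a finitely generated projective $R$-module. (1) For every projective $R$-lattice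 functor $\mathbf P$ there exist integers $f_W\geq 0$, $W\le G$, such that $\mathbf P\simeq\bigoplus_{W\le G} f_W\,\mathbf P^W$ (where $f_W\,\mathbf P^W$ is the direct sum of $f_W$ copies of $\mathbf P^W$). (2) For every finite $G$-set $\Omega$ the functor $\mathbf h^0(R[\Omega])$ is a projective $R$-lattice functor. Let $K_0(\mathcal M_R(G))$ be the Grothendieck group of projective $R$-lattice functors (generated by classes $[\mathbf P]$, with a relation $[\mathbf Y]=[\mathbf X]+[\mathbf Z]$ for every short exact sequence $0\to\mathbf X\to\mathbf Y\to\mathbf Z\to 0$ of such functors), and let $B(G)$ be the Burnside ring of $G$. There is an isomorphism of abelian groups $B(G)\simeq K_0(\mathcal M_R(G))$ with $[\Omega]\mapsto[\mathbf h^0(R[\Omega])]$ for every finite $G$-set $\Omega$; in particular $[G/W]\mapsto[\mathbf P^W]$ for every $W\le G$. (3) As an abelian group, $B(G)\simeq\mathbb Z^{n+1}$. -/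

import Mathlib

open CategoryTheory
open scoped Pointwise

universe u v w

/-! ### Cohomological Mackey functors -/

/-- `S` is a system of representatives of the double cosets `W \ U / V`
(for subgroups `V, W ≤ U`). -/
def IsDoubleCosetReps {G : Type v} [Group G] (W U V : Subgroup G) (S : Finset G) : Prop :=
  (∀ s ∈ S, s ∈ U) ∧ ∀ x ∈ U, ∃! s, s ∈ S ∧ ∃ a ∈ W, ∃ b ∈ V, x = a * s * b

theorem conj_inf_conj_inv {G : Type v} [Group G] (g : G) (V W : Subgroup G) :
    MulAut.conj g • (V ⊓ MulAut.conj g⁻¹ • W) = MulAut.conj g • V ⊓ W := by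
  rw [Subgroup.smul_inf, ← mul_smul, ← map_mul, mul_inv_cancel, map_one, one_smul]

theorem conj_smul_mono {G : Type v} [Group G] {g : G} {U V U' V' : Subgroup G} (h : V ≤ U)
    (hU : MulAut.conj g • U = U') (hV : MulAut.conj g • V = V') : V' ≤ U' := by
  subst hU hV
  exact Subgroup.pointwise_smul_le_pointwise_smul_iff.2 h

theorem conj_conj {G : Type v} [Group G] {g h : G} {U V W : Subgroup G}
    (h1 : MulAut.conj g • U = V) (h2 : MulAut.conj h • V = W) :
    MulAut.conj (h * g) • U = W := by
  rw [map_mul, mul_smul, h1, h2]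

/-- A cohomological `G`-Mackey functor with values in `R`-modules.
`res` is the map `i_{U,V} : X_U → X_V`, `tr` is the map `t_{V,U} : X_V → X_U`, and `cj g` is the
conjugation map `c_{g,U} : X_U → X_{ᵍU}`, where `ᵍU = g U g⁻¹`; the target of `cj` is allowed to be
any subgroup `V` together with a proof that `ᵍU = V`. -/
structure CohMackeyFunctor (R : Type u) [CommRing R] (G : Type v) [Group G] where
  obj : Subgroup G → Type w
  [addCommGroup : ∀ U, AddCommGroup (obj U)]
  [module : ∀ U, Module R (obj U)]
  res : ∀ {U V : Subgroup G}, V ≤ U → (obj U →ₗ[R] obj V)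
  tr : ∀ {U V : Subgroup G}, V ≤ U → (obj V →ₗ[R] obj U)
  cj : ∀ (g : G) {U V : Subgroup G}, MulAut.conj g • U = V → (obj U →ₗ[R] obj V)
  res_self : ∀ {U : Subgroup G} (x : obj U), res (le_refl U) x = x
  tr_self : ∀ {U : Subgroup G} (x : obj U), tr (le_refl U) x = x
  cj_self : ∀ {U : Subgroup G} (g : G) (_ : g ∈ U) (h : MulAut.conj g • U = U) (x : obj U),
    cj g h x = x
  res_res : ∀ {U V W : Subgroup G} (h1 : V ≤ U) (h2 : W ≤ V) (x : obj U),
    res h2 (res h1 x) = res (h2.trans h1) x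
  tr_tr : ∀ {U V W : Subgroup G} (h1 : V ≤ U) (h2 : W ≤ V) (x : obj W),
    tr h1 (tr h2 x) = tr (h2.trans h1) x
  cj_cj : ∀ {U V W : Subgroup G} (g h : G) (h1 : MulAut.conj g • U = V)
    (h2 : MulAut.conj h • V = W) (x : obj U),
    cj h h2 (cj g h1 x) = cj (h * g) (conj_conj h1 h2) x
  res_cj : ∀ {U V U' V' : Subgroup G} (g : G) (h : V ≤ U) (hU : MulAut.conj g • U = U')
    (hV : MulAut.conj g • V = V') (x : obj U),
    res (conj_smul_mono h hU hV) (cj g hU x) = cj g hV (res h x)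
  tr_cj : ∀ {U V U' V' : Subgroup G} (g : G) (h : V ≤ U) (hU : MulAut.conj g • U = U')
    (hV : MulAut.conj g • V = V') (x : obj V),
    tr (conj_smul_mono h hU hV) (cj g hV x) = cj g hU (tr h x)
  mackey : ∀ {U V W : Subgroup G} (hV : V ≤ U) (hW : W ≤ U) (S : Finset G),
    IsDoubleCosetReps W U V S → ∀ x : obj V,
    res hW (tr hV x) = ∑ g ∈ S,
      tr (inf_le_right : MulAut.conj g • V ⊓ W ≤ W)
        (cj g (conj_inf_conj_inv g V W)
          (res (inf_le_left : V ⊓ MulAut.conj g⁻¹ • W ≤ V) x))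
  cohomological : ∀ {U V : Subgroup G} (h : V ≤ U) (x : obj U),
    tr h (res h x) = V.relIndex U • x

namespace CohMackeyFunctor

attribute [instance] CohMackeyFunctor.addCommGroup CohMackeyFunctor.module

variable {R : Type u} [CommRing R] {G : Type v} [Group G]

/-- A homomorphism of cohomological Mackey functors. -/
@[ext]
structure Hom (X Y : CohMackeyFunctor.{u, v, w} R G) where
  app : ∀ U : Subgroup G, X.obj U →ₗ[R] Y.obj U
  app_res : ∀ {U V : Subgroup G} (h : V ≤ U) (x : X.obj U),
    app V (X.res h x) = Y.res h (app U x)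
  app_tr : ∀ {U V : Subgroup G} (h : V ≤ U) (x : X.obj V),
    app U (X.tr h x) = Y.tr h (app V x)
  app_cj : ∀ (g : G) {U V : Subgroup G} (h : MulAut.conj g • U = V) (x : X.obj U),
    app V (X.cj g h x) = Y.cj g h (app U x)

/-- The category of cohomological `G`-Mackey functors with values in `R`-modules. -/
instance : Category (CohMackeyFunctor.{u, v, w} R G) where
  Hom := Hom
  id X :=
    { app := fun _ => LinearMap.id
      app_res := fun _ _ => rfl
      app_tr := fun _ _ => rfl
      app_cj := fun _ _ _ _ _ => rfl }
  comp f g :=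
    { app := fun U => (g.app U).comp (f.app U)
      app_res := fun h x => by simp [f.app_res, g.app_res]
      app_tr := fun h x => by simp [f.app_tr, g.app_tr]
      app_cj := fun a _ _ h x => by simp [f.app_cj, g.app_cj] }

/-- `X` is an `R`-lattice functor: all its values are finitely generated projective
`R`-modules. -/
def IsLattice (X : CohMackeyFunctor.{u, v, w} R G) : Prop :=
  ∀ U, Module.Finite R (X.obj U) ∧ Module.Projective R (X.obj U)

/-- The direct sum of a finite family of cohomological Mackey functors. -/
def directSum {ι : Type v} [Finite ι] (X : ι → CohMackeyFunctor.{u, v, w} R G) :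
    CohMackeyFunctor.{u, v, max v w} R G where
  obj U := ∀ j, (X j).obj U
  res h := LinearMap.pi fun j => ((X j).res h).comp (LinearMap.proj j)
  tr h := LinearMap.pi fun j => ((X j).tr h).comp (LinearMap.proj j)
  cj g _ _ h := LinearMap.pi fun j => ((X j).cj g h).comp (LinearMap.proj j)
  res_self x := funext fun j => (X j).res_self (x j)
  tr_self x := funext fun j => (X j).tr_self (x j)
  cj_self g hg h x := funext fun j => (X j).cj_self g hg h (x j)
  res_res h1 h2 x := funext fun j => (X j).res_res h1 h2 (x j)
  tr_tr h1 h2 x := funext fun j => (X j).tr_tr h1 h2 (x j)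
  cj_cj g h h1 h2 x := funext fun j => (X j).cj_cj g h h1 h2 (x j)
  res_cj g h hU hV x := funext fun j => (X j).res_cj g h hU hV (x j)
  tr_cj g h hU hV x := funext fun j => (X j).tr_cj g h hU hV (x j)
  mackey hV hW S hS x := funext fun j => by
    simpa using (X j).mackey hV hW S hS (x j)
  cohomological h x := funext fun j => (X j).cohomological h (x j)

/-! ### The fixed point functor `h⁰(M)` -/

section FixedPoints

variable {M : Type w} [AddCommGroup M] [Module R M] (ρ : Representation R G M)

/-- The submodule `M^U` of `U`-fixed points. -/
noncomputable def fixedBy (U : Subgroup G) : Submodule R M :=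
  Representation.invariants (MonoidHom.comp ρ U.subtype)

theorem mem_fixedBy {U : Subgroup G} {m : M} : m ∈ fixedBy ρ U ↔ ∀ g ∈ U, ρ g m = m := by
  simp [fixedBy, Representation.mem_invariants]

theorem rho_congr {V : Subgroup G} {m : M} (hm : m ∈ fixedBy ρ V) {a b : G}
    (h : a⁻¹ * b ∈ V) : ρ a m = ρ b m := by
  have := (mem_fixedBy ρ).1 hm _ h
  conv_lhs => rw [← this]
  rw [← Module.End.mul_apply, ← map_mul, mul_inv_cancel_left]

theorem rho_mem {g : G} {U V : Subgroup G} (h : MulAut.conj g • U = V) {m : M}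
    (hm : m ∈ fixedBy ρ U) : ρ g m ∈ fixedBy ρ V := by
  subst h
  rw [mem_fixedBy]
  intro a ha
  obtain ⟨b, hb, rfl⟩ := (Subgroup.mem_smul_pointwise_iff_exists _ _ _).1 ha
  rw [← Module.End.mul_apply, ← map_mul]
  refine rho_congr ρ hm ?_
  simpa [mul_assoc] using hb

theorem mem_conj {g : G} {U V : Subgroup G} (h : MulAut.conj g • U = V) (x : G) :
    x ∈ V ↔ g⁻¹ * x * g ∈ U := by
  subst h
  rw [Subgroup.mem_pointwise_smul_iff_inv_smul_mem]
  simp [MulAut.smul_def, ← map_inv]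

theorem fixedBy_anti {U V : Subgroup G} (h : V ≤ U) : fixedBy ρ U ≤ fixedBy ρ V :=
  fun _ hm => (mem_fixedBy ρ).2 fun g hg => (mem_fixedBy ρ).1 hm g (h hg)

variable [Finite G]

/-- The transfer `m ↦ ∑_{r ∈ U/V} r m`, with chosen representatives `r`. -/
noncomputable def transfer (U V : Subgroup G) : M →ₗ[R] M :=
  letI := Fintype.ofFinite (U ⧸ V.subgroupOf U)
  ∑ q : U ⧸ V.subgroupOf U, ρ (q.out : G)

/-- The transfer may be computed with any family of representatives of `U / V`. -/
theorem transfer_eq_sum {U V : Subgroup G} {m : M} (hm : m ∈ fixedBy ρ V)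
    {ι : Type*} [Fintype ι] (r : ι → G) (hr : ∀ j, r j ∈ U)
    (hex : ∀ x ∈ U, ∃! j, (r j)⁻¹ * x ∈ V) :
    transfer ρ U V m = ∑ j, ρ (r j) m := by
  let _ := Fintype.ofFinite (U ⧸ V.subgroupOf U)
  rw [transfer, LinearMap.sum_apply]
  symm
  let f : ι → U ⧸ V.subgroupOf U := fun j => QuotientGroup.mk ⟨r j, hr j⟩
  have hf : Function.Bijective f := by
    constructor
    · intro j k hjk
      have h1 : (r j)⁻¹ * r k ∈ V := by
        have := QuotientGroup.eq.1 hjk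
        simpa [Subgroup.mem_subgroupOf] using this
      exact (hex (r k) (hr k)).unique h1 (by simp)
    · intro q
      induction q using QuotientGroup.induction_on with
      | H z =>
        obtain ⟨j, hj, -⟩ := hex z z.2
        refine ⟨j, QuotientGroup.eq.2 ?_⟩
        simpa [Subgroup.mem_subgroupOf] using hj
  refine Fintype.sum_bijective f hf _ _ fun j => rho_congr ρ hm ?_
  have h2 : (QuotientGroup.mk ⟨r j, hr j⟩ : U ⧸ V.subgroupOf U) =
      QuotientGroup.mk (Quotient.out (f j)) := (QuotientGroup.out_eq' (f j)).symm
  have := QuotientGroup.eq.1 h2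
  simpa [Subgroup.mem_subgroupOf] using this

theorem exists_reps (U V : Subgroup G) :
    ∃ (ι : Type v) (_ : Fintype ι) (r : ι → G), (∀ j, r j ∈ U) ∧
      (∀ x ∈ U, ∃! j, (r j)⁻¹ * x ∈ V) ∧ Fintype.card ι = V.relIndex U := by
  let _ := Fintype.ofFinite (U ⧸ V.subgroupOf U)
  refine ⟨U ⧸ V.subgroupOf U, inferInstance, fun q => (q.out : G), fun q => q.out.2, ?_, ?_⟩
  · intro x hx
    have key : ∀ q : U ⧸ V.subgroupOf U,
        ((q.out : U) : G)⁻¹ * x ∈ V ↔ q = QuotientGroup.mk ⟨x, hx⟩ := by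
      intro q
      conv_rhs => rw [← QuotientGroup.out_eq' q]
      rw [QuotientGroup.eq]
      simp [Subgroup.mem_subgroupOf]
    exact ⟨QuotientGroup.mk ⟨x, hx⟩, (key _).2 rfl, fun q hq => (key q).1 hq⟩
  · rw [Fintype.card_eq_nat_card]; rfl

theorem transfer_mem {U V : Subgroup G} {m : M} (hm : m ∈ fixedBy ρ V) :
    transfer ρ U V m ∈ fixedBy ρ U := by
  obtain ⟨ι, _, r, hr, hex, -⟩ := exists_reps U V
  rw [mem_fixedBy]
  intro g hg
  conv_rhs => rw [transfer_eq_sum ρ hm (fun j => g * r j) (fun j => U.mul_mem hg (hr j))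
    (fun x hx => by
      simpa [mul_assoc] using hex (g⁻¹ * x) (U.mul_mem (U.inv_mem hg) hx))]
  rw [transfer_eq_sum ρ hm r hr hex, map_sum]
  exact Finset.sum_congr rfl fun j _ => by rw [map_mul]; rfl

theorem transfer_self {U : Subgroup G} {m : M} (hm : m ∈ fixedBy ρ U) :
    transfer ρ U U m = m := by
  rw [transfer_eq_sum ρ hm (fun _ : Unit => 1) (fun _ => U.one_mem)
    (fun x hx => ⟨(), by simpa using hx, fun _ _ => rfl⟩)]
  simp

theorem transfer_transfer {U V W : Subgroup G} (h1 : V ≤ U) (h2 : W ≤ V) {m : M}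
    (hm : m ∈ fixedBy ρ W) : transfer ρ U V (transfer ρ V W m) = transfer ρ U W m := by
  obtain ⟨ι, _, r, hr, hex, -⟩ := exists_reps U V
  obtain ⟨κ, _, s, hs, hes, -⟩ := exists_reps V W
  rw [transfer_eq_sum ρ (transfer_mem ρ hm) r hr hex, transfer_eq_sum ρ hm s hs hes,
    transfer_eq_sum ρ hm (fun q : ι × κ => r q.1 * s q.2)
      (fun q => U.mul_mem (hr _) (h1 (hs _))), Fintype.sum_prod_type]
  · simp [map_mul, map_sum]
  · intro x hx
    obtain ⟨j, hj, hju⟩ := hex x hx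
    obtain ⟨k, hk, hku⟩ := hes _ hj
    refine ⟨(j, k), by simpa [mul_assoc] using hk, ?_⟩
    rintro ⟨j', k'⟩ h'
    simp only [mul_inv_rev, mul_assoc] at h'
    have e1 : j' = j := hju j' (by
      have := V.mul_mem (hs k') (h2 h')
      simpa using this)
    subst e1
    rw [hku k' h']

theorem transfer_rho {g : G} {U V U' V' : Subgroup G}
    (hU : MulAut.conj g • U = U') (hV : MulAut.conj g • V = V') {m : M}
    (hm : m ∈ fixedBy ρ V) : transfer ρ U' V' (ρ g m) = ρ g (transfer ρ U V m) := by
  obtain ⟨ι, _, r, hr, hex, -⟩ := exists_reps U V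
  rw [transfer_eq_sum ρ hm r hr hex,
    transfer_eq_sum ρ (rho_mem ρ hV hm) (fun j => g * r j * g⁻¹), map_sum]
  · refine Finset.sum_congr rfl fun j _ => ?_
    simp only [← Module.End.mul_apply, ← map_mul]
    simp
  · intro j
    rw [mem_conj hU]
    simpa [mul_assoc] using hr j
  · intro x hx
    rw [mem_conj hU] at hx
    simp only [mem_conj hV]
    simpa [mul_assoc] using hex _ hx

theorem transfer_mackey {U V W : Subgroup G} (hW : W ≤ U) (S : Finset G)
    (hS : IsDoubleCosetReps W U V S) {m : M} (hm : m ∈ fixedBy ρ V) :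
    transfer ρ U V m = ∑ g ∈ S, transfer ρ W (MulAut.conj g • V ⊓ W) (ρ g m) := by
  have hmem : ∀ g, ρ g m ∈ fixedBy ρ (MulAut.conj g • V ⊓ W) := fun g => by
    have := rho_mem ρ (rfl : MulAut.conj g • V = MulAut.conj g • V) hm
    rw [mem_fixedBy] at this ⊢
    exact fun a ha => this a ha.1
  choose ι hι r hr hex _ using fun g : S => exists_reps W (MulAut.conj (g : G) • V ⊓ W)
  rw [transfer_eq_sum ρ hm (fun q : (Σ g : S, ι g) => r q.1 q.2 * q.1)
    (fun q => U.mul_mem (hW (hr _ _)) (hS.1 _ q.1.2)), Fintype.sum_sigma, ← Finset.sum_coe_sort S]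
  · refine Finset.sum_congr rfl fun g _ => ?_
    rw [transfer_eq_sum ρ (hmem g) (r g) (hr g) (hex g)]
    simp [map_mul]
  · intro x hx
    obtain ⟨s, ⟨hsS, a, ha, b, hb, rfl⟩, hsu⟩ := hS.2 x hx
    obtain ⟨j, hj, hju⟩ := hex ⟨s, hsS⟩ a ha
    refine ⟨⟨⟨s, hsS⟩, j⟩, ?_, ?_⟩
    · have := (mem_conj rfl _).1 hj.1
      have := V.mul_mem this hb
      simpa [mul_assoc] using this
    · rintro ⟨⟨s', hs'⟩, j'⟩ h'
      have e1 : s' = s := hsu s' ⟨hs', r ⟨s', hs'⟩ j', hr _ _, _, h', by simp [mul_assoc]⟩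
      subst e1
      have e2 : j' = j := hju j' ⟨(mem_conj rfl _).2 (by
        have := V.mul_mem h' (V.inv_mem hb)
        simpa [mul_assoc] using this), W.mul_mem (W.inv_mem (hr _ _)) ha⟩
      rw [e2]

theorem transfer_of_mem {U V : Subgroup G} (h : V ≤ U) {m : M} (hm : m ∈ fixedBy ρ U) :
    transfer ρ U V m = V.relIndex U • m := by
  obtain ⟨ι, _, r, hr, hex, hcard⟩ := exists_reps U V
  have hm' : m ∈ fixedBy ρ V := (mem_fixedBy ρ).2 fun g hg => (mem_fixedBy ρ).1 hm g (h hg)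
  rw [transfer_eq_sum ρ hm' r hr hex, ← hcard,
    Finset.sum_congr rfl fun j _ => (mem_fixedBy ρ).1 hm _ (hr j)]
  simp

/-- The fixed point functor `h⁰(M)`: `h⁰(M)_U = M^U`, with `i` the inclusion, `t` the transfer
and `c_g` multiplication by `g`. -/
noncomputable def fixedPoints : CohMackeyFunctor.{u, v, w} R G where
  obj U := fixedBy ρ U
  res h := Submodule.inclusion (fixedBy_anti ρ h)
  tr {U V} h := (transfer ρ U V).restrict fun _ hm => transfer_mem ρ hm
  cj g _ _ h := (ρ g).restrict fun _ hm => rho_mem ρ h hm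
  res_self _ := rfl
  tr_self x := Subtype.ext (transfer_self ρ x.2)
  cj_self g hg _ x := Subtype.ext ((mem_fixedBy ρ).1 x.2 g hg)
  res_res _ _ _ := rfl
  tr_tr h1 h2 x := Subtype.ext (transfer_transfer ρ h1 h2 x.2)
  cj_cj g h _ _ x := Subtype.ext (by simp [map_mul])
  res_cj _ _ _ _ _ := rfl
  tr_cj _ _ hU hV x := Subtype.ext (transfer_rho ρ hU hV x.2)
  mackey hV hW S hS x := Subtype.ext (by
    rw [AddSubmonoidClass.coe_finsetSum]
    exact transfer_mackey ρ hW S hS x.2)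
  cohomological h x := Subtype.ext (transfer_of_mem ρ h x.2)

end FixedPoints

variable (R) in
/-- The functor `h⁰(R[Ω])` of a `G`-set `Ω`, where `R[Ω]` is the permutation module. -/
noncomputable def permutation [Finite G] (Ω : Type v) [MulAction G Ω] :
    CohMackeyFunctor.{u, v, max u v} R G :=
  fixedPoints (Representation.ofMulAction R G Ω)

variable (R) in
/-- The standard projective `P^W`, with `P^W_U = Hom_G(R[G/U], R[G/W]) = R[G/W]^U`. -/
noncomputable def standardProjective [Finite G] (W : Subgroup G) :
    CohMackeyFunctor.{u, v, max u v} R G :=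
  permutation R (G ⧸ W)

/-! ### The Grothendieck group `K₀(M_R(G))` -/

variable (R G) in
/-- Projective `R`-lattice functors: projective objects of the category of all cohomological
`G`-Mackey functors with values in `R`-modules, all of whose values are `R`-lattices. -/
structure ProjectiveLattice where
  functor : CohMackeyFunctor.{u, v, max u v} R G
  projective : Projective functor
  isLattice : functor.IsLattice

/-- `0 → X → Y → Z → 0` is a short exact sequence (objectwise). -/
def IsShortExact {X Y Z : CohMackeyFunctor.{u, v, w} R G} (f : X ⟶ Y) (g : Y ⟶ Z) : Prop :=
  ∀ U, Function.Injective (Hom.app f U) ∧ Function.Exact (Hom.app f U) (Hom.app g U) ∧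
    Function.Surjective (Hom.app g U)

variable (R G) in
/-- The subgroup of relations `[Y] - [X] - [Z]`, one for each short exact sequence
`0 → X → Y → Z → 0` of projective `R`-lattice functors. -/
def K0Relations : AddSubgroup (FreeAbelianGroup (ProjectiveLattice.{u, v} R G)) :=
  AddSubgroup.closure {a | ∃ (X Y Z : ProjectiveLattice.{u, v} R G)
    (f : X.functor ⟶ Y.functor) (g : Y.functor ⟶ Z.functor), IsShortExact f g ∧
    a = FreeAbelianGroup.of Y - FreeAbelianGroup.of X - FreeAbelianGroup.of Z}

variable (R G) in
/-- The Grothendieck group `K₀(M_R(G))` of projective `R`-lattice functors. -/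
abbrev K0 : Type _ :=
  FreeAbelianGroup (ProjectiveLattice.{u, v} R G) ⧸ K0Relations.{u, v} R G

/-- The class `[P]` in `K₀(M_R(G))`. -/
def K0.mk (P : ProjectiveLattice.{u, v} R G) : K0.{u, v} R G :=
  QuotientAddGroup.mk (FreeAbelianGroup.of P)

end CohMackeyFunctor

/-! ### The Burnside ring -/

/-- Finite `G`-sets. -/
structure FiniteGSet (G : Type v) [Group G] where
  carrier : Type v
  [finite : Finite carrier]
  [mulAction : MulAction G carrier]

namespace FiniteGSet

attribute [instance] FiniteGSet.finite FiniteGSet.mulAction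

variable {G : Type v} [Group G]

/-- Isomorphism of `G`-sets. -/
def Iso (X Y : FiniteGSet G) : Prop :=
  ∃ e : X.carrier ≃ Y.carrier, ∀ (g : G) (x : X.carrier), e (g • x) = g • e x

variable (G) in
/-- The setoid of isomorphism of finite `G`-sets. -/
def isoSetoid : Setoid (FiniteGSet G) where
  r := Iso
  iseqv :=
    { refl := fun _ => ⟨Equiv.refl _, fun _ _ => rfl⟩
      symm := fun ⟨e, he⟩ => ⟨e.symm, fun g x => by rw [e.symm_apply_eq, he]; simp⟩
      trans := fun ⟨e, he⟩ ⟨f, hf⟩ => ⟨e.trans f, fun g x => by simp [he, hf]⟩ }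

/-- The disjoint union of two finite `G`-sets. -/
def sum (X Y : FiniteGSet G) : FiniteGSet G := ⟨X.carrier ⊕ Y.carrier⟩

/-- The product of two finite `G`-sets, with the diagonal action. -/
def prod (X Y : FiniteGSet G) : FiniteGSet G := ⟨X.carrier × Y.carrier⟩

variable (G) in
/-- The one-point `G`-set. -/
def point : FiniteGSet G where
  carrier := PUnit
  mulAction :=
    { smul := fun _ x => x
      one_smul := fun _ => rfl
      mul_smul := fun _ _ _ => rfl }

/-- The transitive `G`-set `G/W`. -/
def coset [Finite G] (W : Subgroup G) : FiniteGSet G := ⟨G ⧸ W⟩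

variable (G) in
/-- Isomorphism classes of finite `G`-sets. -/
def IsoClass : Type (v + 1) := Quotient (isoSetoid G)

/-- Isomorphism classes of finite `G`-sets form a commutative monoid under the product. -/
instance : CommMonoid (IsoClass G) where
  mul := Quotient.map₂ prod (fun _ _ ⟨e, he⟩ _ _ ⟨f, hf⟩ =>
    ⟨Equiv.prodCongr e f, fun g x => Prod.ext (he g x.1) (hf g x.2)⟩)
  one := Quotient.mk _ (point G)
  mul_assoc := by
    rintro ⟨X⟩ ⟨Y⟩ ⟨Z⟩
    exact Quotient.sound ⟨Equiv.prodAssoc _ _ _, fun _ _ => rfl⟩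
  one_mul := by
    rintro ⟨X⟩
    exact Quotient.sound ⟨Equiv.punitProd _, fun _ _ => rfl⟩
  mul_one := by
    rintro ⟨X⟩
    exact Quotient.sound ⟨Equiv.prodPUnit _, fun _ _ => rfl⟩
  mul_comm := by
    rintro ⟨X⟩ ⟨Y⟩
    exact Quotient.sound ⟨Equiv.prodComm _ _, fun _ _ => rfl⟩

/-- The isomorphism class of a finite `G`-set. -/
def isoClass (X : FiniteGSet G) : IsoClass G := Quotient.mk _ X

variable (G) in
/-- The ideal generated by the elements `[X ⊔ Y] - [X] - [Y]`; because the product of `G`-sets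
distributes over disjoint unions, it is the additive subgroup generated by these elements. -/
noncomputable def burnsideIdeal : Ideal (MonoidAlgebra ℤ (IsoClass G)) :=
  Ideal.span {a | ∃ X Y : FiniteGSet G,
    a = MonoidAlgebra.of ℤ _ (isoClass (sum X Y)) - MonoidAlgebra.of ℤ _ (isoClass X) -
      MonoidAlgebra.of ℤ _ (isoClass Y)}

end FiniteGSet

/-- The Burnside ring of `G`: generated by the isomorphism classes of finite `G`-sets, with
addition induced by disjoint union and multiplication induced by the product. -/
abbrev BurnsideRing (G : Type v) [Group G] : Type (v + 1) :=
  MonoidAlgebra ℤ (FiniteGSet.IsoClass G) ⧸ FiniteGSet.burnsideIdeal G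

/-- The class `[X]` of a finite `G`-set in the Burnside ring. -/
noncomputable def BurnsideRing.mk {G : Type v} [Group G] (X : FiniteGSet G) : BurnsideRing G :=
  Ideal.Quotient.mk _ (MonoidAlgebra.of ℤ _ X.isoClass)

/-! The subgroups of a cyclic p-group form a chain, and this makes P^W represent evaluation at W.
For U ≤ W restriction from W to U is bijective on P^W, for W ≤ U transfer from W to U is surjective,
and P^W_W is spanned by the translates of one element `gen`. So a homomorphism P^W ⟶ X is determined
by the image of `gen`, and every element of X_W is such an image (`standardProjective_hom_ext`,
`exists_hom_standardProjective`). Since epimorphisms are objectwise surjective, P^W is projective;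
splitting a finite G-set into orbits then shows that its permutation functor is projective.

The classification is a projective cover argument. The radical `rad` of X at U collects 𝔪X_U, (g₀ -
1)X_U and all proper transfers and restrictions into X_U. Nakayama's lemma holds for it
(`eq_top_of_sup_rad_eq_top`), because transfer after restriction is multiplication by an index,
proper indices lie in 𝔪, and g₀ - 1 is nilpotent modulo p. Minimal generators of the P_U modulo the
radical define a map from a sum of standard projectives to P. It is onto by Nakayama and splits
because P is projective. By minimality its kernel lies in the radical, so the splitting is onto by
Nakayama again, and the map is an isomorphism.

Consequently B(G) → K₀ is onto. Ranks of values are additive on short exact sequences, and if H_i is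
the subgroup of index p^i, then P^{H_j} has rank p^min(i,j) at H_i. This matrix is nonsingular
(`eq_zero_of_sum_mul_min`), so the classes [P^W] are independent in K₀. The classes [G/W], which
generate B(G), are then independent too, and both isomorphisms follow. -/

namespace CohMackeyFunctor

variable {R : Type u} [CommRing R] {G : Type v} [Group G]

/-! ### Isomorphisms, quotients and epimorphisms of Mackey functors -/

section Basic

variable {X Y Z : CohMackeyFunctor.{u, v, w} R G}

@[simp]
theorem id_app (U : Subgroup G) : Hom.app (𝟙 X) U = LinearMap.id := rfl

@[simp]
theorem comp_app (f : X ⟶ Y) (g : Y ⟶ Z) (U : Subgroup G) :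
    Hom.app (f ≫ g) U = (Hom.app g U).comp (Hom.app f U) := rfl

theorem hom_ext {f g : X ⟶ Y} (h : ∀ U x, Hom.app f U x = Hom.app g U x) : f = g :=
  Hom.ext (funext fun U => LinearMap.ext (h U))

theorem congr_app {f g : X ⟶ Y} (h : f = g) (U : Subgroup G) (x : X.obj U) :
    Hom.app f U x = Hom.app g U x := by rw [h]

/-- An objectwise bijective homomorphism is an isomorphism. -/
noncomputable def isoOfBijective (f : X ⟶ Y) (hf : ∀ U, Function.Bijective (Hom.app f U)) :
    X ≅ Y where
  hom := f
  inv :=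
    { app := fun U => (LinearEquiv.ofBijective (Hom.app f U) (hf U)).symm.toLinearMap
      app_res := fun h x => by
        obtain ⟨x, rfl⟩ := (hf _).2 x
        apply (hf _).1
        simp [← Hom.app_res]
      app_tr := fun h x => by
        obtain ⟨x, rfl⟩ := (hf _).2 x
        apply (hf _).1
        simp [← Hom.app_tr]
      app_cj := fun g _ _ h x => by
        obtain ⟨x, rfl⟩ := (hf _).2 x
        apply (hf _).1
        simp [← Hom.app_cj] }
  hom_inv_id := hom_ext fun U x =>
    (LinearEquiv.ofBijective (Hom.app f U) (hf U)).symm_apply_apply x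
  inv_hom_id := hom_ext fun U x =>
    (LinearEquiv.ofBijective (Hom.app f U) (hf U)).apply_symm_apply x

/-- The quotient of a Mackey functor by a family of submodules stable under its operations. -/
def quotient (Y : CohMackeyFunctor.{u, v, w} R G) (N : ∀ U, Submodule R (Y.obj U))
    (hres : ∀ {U V : Subgroup G} (h : V ≤ U), N U ≤ (N V).comap (Y.res h))
    (htr : ∀ {U V : Subgroup G} (h : V ≤ U), N V ≤ (N U).comap (Y.tr h))
    (hcj : ∀ (g : G) {U V : Subgroup G} (h : MulAut.conj g • U = V),
      N U ≤ (N V).comap (Y.cj g h)) : CohMackeyFunctor.{u, v, w} R G where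
  obj U := Y.obj U ⧸ N U
  res h := (N _).mapQ _ _ (hres h)
  tr h := (N _).mapQ _ _ (htr h)
  cj g _ _ h := (N _).mapQ _ _ (hcj g h)
  res_self x := by
    obtain ⟨x, rfl⟩ := Submodule.Quotient.mk_surjective _ x
    simp [res_self]
  tr_self x := by
    obtain ⟨x, rfl⟩ := Submodule.Quotient.mk_surjective _ x
    simp [tr_self]
  cj_self g hg h x := by
    obtain ⟨x, rfl⟩ := Submodule.Quotient.mk_surjective _ x
    simp [cj_self _ g hg h]
  res_res h1 h2 x := by
    obtain ⟨x, rfl⟩ := Submodule.Quotient.mk_surjective _ x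
    simp [res_res]
  tr_tr h1 h2 x := by
    obtain ⟨x, rfl⟩ := Submodule.Quotient.mk_surjective _ x
    simp [tr_tr]
  cj_cj g h h1 h2 x := by
    obtain ⟨x, rfl⟩ := Submodule.Quotient.mk_surjective _ x
    simp [cj_cj]
  res_cj g h hU hV x := by
    obtain ⟨x, rfl⟩ := Submodule.Quotient.mk_surjective _ x
    simp [Y.res_cj g h hU hV]
  tr_cj g h hU hV x := by
    obtain ⟨x, rfl⟩ := Submodule.Quotient.mk_surjective _ x
    simp [Y.tr_cj g h hU hV]
  mackey hV hW S hS x := by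
    obtain ⟨x, rfl⟩ := Submodule.Quotient.mk_surjective _ x
    refine (congrArg (N _).mkQ (Y.mackey hV hW S hS x)).trans ?_
    rw [map_sum]
    rfl
  cohomological h x := by
    obtain ⟨x, rfl⟩ := Submodule.Quotient.mk_surjective _ x
    simp [Y.cohomological]

/-- Epimorphisms of Mackey functors are objectwise surjective. -/
theorem surjective_of_epi (f : X ⟶ Y) [Epi f] (U : Subgroup G) :
    Function.Surjective (Hom.app f U) := by
  -- `Q` is the cokernel of `f`. The projection and the zero map agree after `f`, hence are equal,
  -- so `Q` vanishes.
  let Q : CohMackeyFunctor.{u, v, w} R G :=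
    Y.quotient (fun U => LinearMap.range (Hom.app f U))
      (by rintro U V h _ ⟨x, rfl⟩; exact ⟨_, Hom.app_res f h x⟩)
      (by rintro U V h _ ⟨x, rfl⟩; exact ⟨_, Hom.app_tr f h x⟩)
      (by rintro g U V h _ ⟨x, rfl⟩; exact ⟨_, Hom.app_cj f g h x⟩)
  let π : Y ⟶ Q :=
    { app := fun U => Submodule.mkQ _
      app_res := fun _ _ => rfl
      app_tr := fun _ _ => rfl
      app_cj := fun _ _ _ _ _ => rfl }
  let z : Y ⟶ Q :=
    { app := fun U => 0
      app_res := fun _ _ => by simp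
      app_tr := fun _ _ => by simp
      app_cj := fun _ _ _ _ _ => by simp }
  have hπ : π = z := by
    rw [← cancel_epi f]
    refine hom_ext fun U x => ?_
    exact (Submodule.Quotient.mk_eq_zero _).2 ⟨x, rfl⟩
  intro y
  exact (Submodule.Quotient.mk_eq_zero _).1 (congr_app hπ U y)

theorem epi_of_surjective (f : X ⟶ Y) (hf : ∀ U, Function.Surjective (Hom.app f U)) : Epi f where
  left_cancellation g h e := hom_ext fun U y => by
    obtain ⟨x, rfl⟩ := hf U y
    exact congr_app e U x

end Basic

/-! ### Finite direct sums as biproducts -/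

section DirectSum

variable {ι : Type v} [Finite ι] (X : ι → CohMackeyFunctor.{u, v, max u v} R G)
  {Y : CohMackeyFunctor.{u, v, max u v} R G}

/-- The homomorphism out of a direct sum with given components. -/
noncomputable def directSum.desc (f : ∀ j, X j ⟶ Y) : directSum X ⟶ Y :=
  letI := Fintype.ofFinite ι
  { app := fun U => ∑ j, (Hom.app (f j) U).comp (LinearMap.proj j)
    app_res := fun h x => by
      simp only [LinearMap.sum_apply, map_sum]
      exact Finset.sum_congr rfl fun j _ => Hom.app_res (f j) h (x j)
    app_tr := fun h x => by
      simp only [LinearMap.sum_apply, map_sum]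
      exact Finset.sum_congr rfl fun j _ => Hom.app_tr (f j) h (x j)
    app_cj := fun g _ _ h x => by
      simp only [LinearMap.sum_apply, map_sum]
      exact Finset.sum_congr rfl fun j _ => Hom.app_cj (f j) g h (x j) }

/-- The projection to a component of a direct sum. -/
def directSum.proj (j : ι) : directSum X ⟶ X j where
  app U := LinearMap.proj (φ := fun j => (X j).obj U) j
  app_res _ _ := rfl
  app_tr _ _ := rfl
  app_cj _ _ _ _ _ := rfl

open Classical in
/-- The inclusion of a component of a direct sum. -/
noncomputable def directSum.incl (j : ι) : X j ⟶ directSum X where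
  app U := LinearMap.single R (fun j => (X j).obj U) j
  app_res h x := funext fun k =>
    (Pi.apply_single (fun k => (X k).res h) (fun _ => map_zero _) j x k).symm
  app_tr h x := funext fun k =>
    (Pi.apply_single (fun k => (X k).tr h) (fun _ => map_zero _) j x k).symm
  app_cj g _ _ h x := funext fun k =>
    (Pi.apply_single (fun k => (X k).cj g h) (fun _ => map_zero _) j x k).symm

/-- The homomorphism into a direct sum with given components. -/
def directSum.lift (f : ∀ j, Y ⟶ X j) : Y ⟶ directSum X where
  app U := LinearMap.pi fun j => Hom.app (f j) U
  app_res h x := funext fun j => Hom.app_res (f j) h x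
  app_tr h x := funext fun j => Hom.app_tr (f j) h x
  app_cj g _ _ h x := funext fun j => Hom.app_cj (f j) g h x

variable {X} in
theorem directSum.ext {U : Subgroup G} {x y : (directSum X).obj U}
    (h : ∀ j, Hom.app (directSum.proj X j) U x = Hom.app (directSum.proj X j) U y) : x = y :=
  funext h

theorem directSum.desc_app [Fintype ι] (f : ∀ j, X j ⟶ Y) (U : Subgroup G)
    (x : (directSum X).obj U) :
    Hom.app (directSum.desc X f) U x = ∑ j, Hom.app (f j) U (Hom.app (directSum.proj X j) U x) := by
  obtain rfl : ‹Fintype ι› = Fintype.ofFinite ι := Subsingleton.elim _ _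
  exact LinearMap.sum_apply _ _ _

theorem directSum.sum_incl [Fintype ι] (U : Subgroup G) (x : (directSum X).obj U) :
    ∑ j, Hom.app (directSum.incl X j) U (Hom.app (directSum.proj X j) U x) = x := by
  classical
  exact (Finset.sum_congr rfl fun j _ => by congr!).trans
    (Finset.univ_sum_single (M := fun j => (X j).obj U) x)

theorem directSum.desc_incl (f : ∀ j, X j ⟶ Y) (j : ι) (U : Subgroup G) (x : (X j).obj U) :
    Hom.app (directSum.desc X f) U (Hom.app (directSum.incl X j) U x) = Hom.app (f j) U x := by
  classical
  have := Fintype.ofFinite ι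
  have h1 : ∀ k, k ≠ j →
      Hom.app (directSum.proj X k) U (Hom.app (directSum.incl X j) U x) = 0 := fun k hk =>
    Pi.single_eq_of_ne (M := fun j => (X j).obj U) hk x
  have h2 : Hom.app (directSum.proj X j) U (Hom.app (directSum.incl X j) U x) = x :=
    Pi.single_eq_same (M := fun j => (X j).obj U) j x
  rw [directSum.desc_app, Fintype.sum_eq_single j, h2]
  intro k hk
  rw [h1 k hk, map_zero]

theorem projective_directSum (hX : ∀ j, Projective (X j)) : Projective (directSum X) where
  factors {E Y} f e _ := by
    have := Fintype.ofFinite ι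
    refine ⟨directSum.desc X fun j => Projective.factorThru (directSum.incl X j ≫ f) e,
      hom_ext fun U x => ?_⟩
    have h1 := fun j => congr_app (Projective.factorThru_comp (directSum.incl X j ≫ f) e) U
      (Hom.app (directSum.proj X j) U x)
    simp only [comp_app, LinearMap.comp_apply] at h1 ⊢
    rw [directSum.desc_app, map_sum]
    simp only [h1]
    rw [← map_sum, directSum.sum_incl]

end DirectSum

/-! ### Functoriality of fixed points -/

section FixedPointsMaps

variable [Finite G] {M N : Type w} [AddCommGroup M] [Module R M] [AddCommGroup N] [Module R N]
  {ρ : Representation R G M} {σ : Representation R G N}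

theorem map_transfer {f : M →ₗ[R] N} (hf : ∀ g m, f (ρ g m) = σ g (f m)) (U V : Subgroup G)
    (m : M) : f (transfer ρ U V m) = transfer σ U V (f m) := by
  simp [transfer, LinearMap.sum_apply, map_sum, hf]

/-- An equivariant map induces a homomorphism of fixed point functors. -/
noncomputable def fixedPointsMap (f : M →ₗ[R] N) (hf : ∀ g m, f (ρ g m) = σ g (f m)) :
    fixedPoints ρ ⟶ fixedPoints σ where
  app U := f.restrict fun m hm => (mem_fixedBy σ).2 fun g hg => by
    rw [← hf, (mem_fixedBy ρ).1 hm g hg]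
  app_res _ _ := rfl
  app_tr _ x := Subtype.ext (map_transfer hf _ _ (Subtype.val (p := (· ∈ fixedBy ρ _)) x))
  app_cj g _ _ _ x := Subtype.ext (hf g (Subtype.val (p := (· ∈ fixedBy ρ _)) x))

end FixedPointsMaps

/-! ### Permutation functors and disjoint unions -/

section Permutation

open MonoidAlgebra (single)

variable (R) in
/-- The linear map of permutation modules induced by a map of sets. -/
noncomputable def permMap {A B : Type v} (e : A → B) :
    MonoidAlgebra R A →ₗ[R] MonoidAlgebra R B :=
  (MonoidAlgebra.coeffLinearEquiv R).symm.toLinearMap ∘ₗ Finsupp.lmapDomain R R e ∘ₗ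
    (MonoidAlgebra.coeffLinearEquiv R).toLinearMap

variable (R) in
/-- Restriction of coefficients along an injective map of sets. -/
noncomputable def permPull {A B : Type v} (e : A → B) (he : Function.Injective e) :
    MonoidAlgebra R B →ₗ[R] MonoidAlgebra R A :=
  (MonoidAlgebra.coeffLinearEquiv R).symm.toLinearMap ∘ₗ Finsupp.lcomapDomain e he ∘ₗ
    (MonoidAlgebra.coeffLinearEquiv R).toLinearMap

section

variable {A B C : Type v}

theorem permMap_single (e : A → B) (a : A) (r : R) :
    permMap R e (single a r) = single (e a) r := by
  simp [permMap]

theorem coeff_permMap {e : A → B} (he : Function.Injective e) (m : MonoidAlgebra R A) (a : A) :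
    (permMap R e m).coeff (e a) = m.coeff a :=
  Finsupp.mapDomain_apply he _ _

theorem coeff_permMap_of_notMem {e : A → B} (m : MonoidAlgebra R A) {b : B}
    (hb : b ∉ Set.range e) : (permMap R e m).coeff b = 0 :=
  Finsupp.mapDomain_of_notMem_range _ _ hb

theorem coeff_permPull {e : A → B} (he : Function.Injective e) (m : MonoidAlgebra R B) (a : A) :
    (permPull R e he m).coeff a = m.coeff (e a) := rfl

theorem perm_ext {x y : MonoidAlgebra R A} (h : ∀ a, x.coeff a = y.coeff a) : x = y :=
  MonoidAlgebra.coeff_injective (Finsupp.ext h)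

variable [MulAction G A] [MulAction G B]

theorem permMap_equivariant {e : A → B} (he : ∀ (g : G) a, e (g • a) = g • e a) (g : G)
    (m : MonoidAlgebra R A) : permMap R e (Representation.ofMulAction R G A g m) =
      Representation.ofMulAction R G B g (permMap R e m) := by
  induction m using MonoidAlgebra.induction_linear with
  | zero => simp
  | add x y hx hy => simp [hx, hy]
  | single a r => simp [permMap_single, he]

theorem permPull_equivariant {e : A → B} (hi : Function.Injective e)
    (he : ∀ (g : G) a, e (g • a) = g • e a) (g : G) (m : MonoidAlgebra R B) :
    permPull R e hi (Representation.ofMulAction R G B g m) =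
      Representation.ofMulAction R G A g (permPull R e hi m) :=
  perm_ext fun a => by
    simp [coeff_permPull, he]

end

variable [Finite G] {A B : Type v} [MulAction G A] [MulAction G B]

/-- The coefficient at `a` of an element of a value of a permutation functor. -/
noncomputable def permCoeff {U : Subgroup G} (a : A) : (permutation R (G := G) A).obj U →ₗ[R] R :=
  (Finsupp.lapply a ∘ₗ (MonoidAlgebra.coeffLinearEquiv R).toLinearMap) ∘ₗ
    (fixedBy (Representation.ofMulAction R G A) U).subtype

theorem permCoeff_ext {U : Subgroup G} {x y : (permutation R (G := G) A).obj U}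
    (h : ∀ a : A, permCoeff a x = permCoeff a y) : x = y :=
  Subtype.ext (perm_ext h)

variable (R) in
/-- The homomorphism of permutation functors induced by a map of `G`-sets. -/
noncomputable def permutationMap (e : A → B) (he : ∀ (g : G) a, e (g • a) = g • e a) :
    permutation R (G := G) A ⟶ permutation R B :=
  fixedPointsMap (permMap R e) (permMap_equivariant he)

variable (R) in
/-- The homomorphism of permutation functors restricting coefficients along an injective map
of `G`-sets. -/
noncomputable def permutationPull (e : A → B) (hi : Function.Injective e)
    (he : ∀ (g : G) a, e (g • a) = g • e a) : permutation R (G := G) B ⟶ permutation R A :=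
  fixedPointsMap (permPull R e hi) (permPull_equivariant hi he)

theorem permCoeff_map {e : A → B} (hi : Function.Injective e)
    (he : ∀ (g : G) a, e (g • a) = g • e a) {U : Subgroup G}
    (x : (permutation R (G := G) A).obj U) (a : A) :
    permCoeff (e a) (Hom.app (permutationMap R e he) U x) = permCoeff a x :=
  coeff_permMap hi _ a

theorem permCoeff_map_of_notMem {e : A → B}
    (he : ∀ (g : G) a, e (g • a) = g • e a) {U : Subgroup G}
    (x : (permutation R (G := G) A).obj U) {b : B} (hb : b ∉ Set.range e) :
    permCoeff b (Hom.app (permutationMap R e he) U x) = 0 :=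
  coeff_permMap_of_notMem _ hb

theorem permCoeff_pull {e : A → B} (hi : Function.Injective e)
    (he : ∀ (g : G) a, e (g • a) = g • e a) {U : Subgroup G}
    (x : (permutation R (G := G) B).obj U) (a : A) :
    permCoeff a (Hom.app (permutationPull R e hi he) U x) = permCoeff (e a) x := rfl

variable (R) in
/-- Isomorphic `G`-sets have isomorphic permutation functors. -/
noncomputable def permutationCongr (e : A ≃ B)
    (he : ∀ (g : G) a, e (g • a) = g • e a) : permutation R (G := G) A ≅ permutation R B where
  hom := permutationMap R e he
  inv := permutationPull R e e.injective he
  hom_inv_id := hom_ext fun _ _ => permCoeff_ext fun a => permCoeff_map e.injective he _ a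
  inv_hom_id := hom_ext fun _ _ => permCoeff_ext fun b => by
    obtain ⟨a, rfl⟩ := e.surjective b
    exact permCoeff_map e.injective he _ a

variable (R) in
/-- The permutation functor of a disjoint union is the direct sum of the permutation functors. -/
noncomputable def permutationSigma {ι : Type v} [Finite ι] (A : ι → Type v)
    [∀ j, MulAction G (A j)] :
    directSum (fun j => permutation R (G := G) (A j)) ≅ permutation R (Σ j, A j) :=
  isoOfBijective (directSum.desc _ fun j => permutationMap R (Sigma.mk j) fun _ _ => rfl)
    fun U => by
    classical
    have := Fintype.ofFinite ι
    have hi := fun j => sigma_mk_injective (β := A) (i := j)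
    have key : ∀ (x : (directSum fun j => permutation R (G := G) (A j)).obj U) (j : ι) (a : A j),
        permCoeff (⟨j, a⟩ : Σ j, A j) (Hom.app (directSum.desc _ fun j =>
          permutationMap R (Sigma.mk j) fun _ _ => rfl) U x) =
        permCoeff a (Hom.app (directSum.proj _ j) U x) := by
      intro x j a
      rw [directSum.desc_app, map_sum, Finset.sum_eq_single j]
      · exact permCoeff_map (hi j) _ _ a
      · intro k _ hk
        refine permCoeff_map_of_notMem _ _ ?_
        rintro ⟨b, hb⟩
        exact hk (congrArg Sigma.fst hb)
      · simp
    refine ⟨fun x y h => directSum.ext fun j => permCoeff_ext fun a => ?_, fun y =>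
      ⟨Hom.app (directSum.lift _ fun j =>
        permutationPull R (Sigma.mk j) (hi j) fun _ _ => rfl) U y, permCoeff_ext ?_⟩⟩
    · rw [← key, h, key]
    · rintro ⟨j, a⟩
      rw [key]
      rfl

-- This exact sequence, split by the other inclusion and pullback, is the relation that makes Ω ↦
-- [h⁰(R[Ω])] additive.
variable (R A B) in
theorem exists_isShortExact_permutation_sum :
    ∃ (f : permutation R (G := G) A ⟶ permutation R (A ⊕ B))
      (g : permutation R (G := G) (A ⊕ B) ⟶ permutation R B), IsShortExact f g := by
  have hl : ∀ (g : G) (a : A), (Sum.inl (g • a) : A ⊕ B) = g • Sum.inl a := fun _ _ => rfl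
  have hr : ∀ (g : G) (b : B), (Sum.inr (g • b) : A ⊕ B) = g • Sum.inr b := fun _ _ => rfl
  have il : Function.Injective (Sum.inl : A → A ⊕ B) := Sum.inl_injective
  have ir : Function.Injective (Sum.inr : B → A ⊕ B) := Sum.inr_injective
  have hn : ∀ b : B, (Sum.inr b : A ⊕ B) ∉ Set.range Sum.inl := by simp
  refine ⟨permutationMap R Sum.inl hl, permutationPull R Sum.inr ir hr,
    fun U => ⟨fun x y h => permCoeff_ext fun a => ?_, fun y => ⟨fun h =>
      ⟨Hom.app (permutationPull R Sum.inl il hl) U y, permCoeff_ext ?_⟩, ?_⟩,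
      fun z => ⟨Hom.app (permutationMap R Sum.inr hr) U z, permCoeff_ext fun b => ?_⟩⟩⟩
  · rw [← permCoeff_map il hl, h, permCoeff_map il hl]
  · rintro (a | b)
    · rw [permCoeff_map il hl, permCoeff_pull]
    · rw [permCoeff_map_of_notMem hl _ (hn b), ← permCoeff_pull ir hr, h, map_zero]
  · rintro ⟨x, rfl⟩
    exact permCoeff_ext fun b => by
      rw [permCoeff_pull, permCoeff_map_of_notMem hl _ (hn b), map_zero]
  · rw [permCoeff_pull, permCoeff_map ir hr]

/-- Fixed points are a submodule of R[A], which is free of finite rank over a principal ideal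
domain. -/
theorem isLattice_permutation [IsDomain R] [IsPrincipalIdealRing R] (A : Type v) [Finite A]
    [MulAction G A] : (permutation R (G := G) A).IsLattice := fun U => by
  have : Module.Free R (MonoidAlgebra R A) :=
    Module.Free.of_equiv (MonoidAlgebra.coeffLinearEquiv R).symm
  have : Module.Finite R (MonoidAlgebra R A) :=
    Module.Finite.equiv (MonoidAlgebra.coeffLinearEquiv R).symm
  exact ⟨inferInstanceAs (Module.Finite R (fixedBy (Representation.ofMulAction R G A) U)),
    inferInstanceAs (Module.Projective R (fixedBy (Representation.ofMulAction R G A) U))⟩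

end Permutation

/-- A `G`-set is the disjoint union of its orbits. -/
theorem exists_equiv_sigma_quotient_stabilizer (A : Type v) [MulAction G A] :
    ∃ e : A ≃ Σ o : MulAction.orbitRel.Quotient G A, G ⧸ MulAction.stabilizer G o.out,
      ∀ (g : G) a, e (g • a) = g • e a := by
  let f : (Σ o : MulAction.orbitRel.Quotient G A, G ⧸ MulAction.stabilizer G o.out) → A :=
    fun x => MulAction.ofQuotientStabilizer G x.1.out x.2
  have hf : ∀ (g : G) x, f (g • x) = g • f x := fun g x =>
    MulAction.ofQuotientStabilizer_smul G _ g x.2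
  -- The orbit of `f x` recovers the index of the summand, which reduces injectivity to a single
  -- orbit.
  have hm : ∀ x, (Quotient.mk'' (f x) : MulAction.orbitRel.Quotient G A) = x.1 := by
    rintro ⟨o, q⟩
    exact (Quotient.sound' (MulAction.ofQuotientStabilizer_mem_orbit G _ q)).trans
      (Quotient.out_eq' o)
  have hb : Function.Bijective f := by
    constructor
    · intro x y h
      have h1 : x.1 = y.1 := by rw [← hm x, ← hm y, h]
      obtain ⟨o, q⟩ := x
      obtain ⟨o', q'⟩ := y
      obtain rfl : o = o' := h1
      exact congrArg (Sigma.mk o) (MulAction.injective_ofQuotientStabilizer G _ h)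
    · intro a
      obtain ⟨g, hg⟩ := Quotient.exact' (Quotient.out_eq' (Quotient.mk'' a :
        MulAction.orbitRel.Quotient G A)).symm
      exact ⟨⟨Quotient.mk'' a, (g : G)⟩, hg⟩
  refine ⟨(Equiv.ofBijective f hb).symm, fun g a => ?_⟩
  rw [Equiv.symm_apply_eq, Equiv.ofBijective_apply, hf]
  congr 1
  exact ((Equiv.ofBijective f hb).apply_symm_apply a).symm

/-! ### Mackey functors of an abelian group: the action on values -/

section Act

variable [IsMulCommutative G]

theorem conj_smul_eq_self (g : G) (U : Subgroup G) : MulAut.conj g • U = U := by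
  ext x
  rw [mem_conj rfl, mul_comm' g⁻¹ x, inv_mul_cancel_right]

variable (X : CohMackeyFunctor.{u, v, w} R G)

/-- The action of an abelian group `G` on a value of a Mackey functor. -/
def act (g : G) (U : Subgroup G) : X.obj U →ₗ[R] X.obj U := X.cj g (conj_smul_eq_self g U)

theorem act_of_mem {g : G} {U : Subgroup G} (hg : g ∈ U) (x : X.obj U) : X.act g U x = x :=
  X.cj_self g hg _ x

theorem act_act (g h : G) (U : Subgroup G) (x : X.obj U) :
    X.act h U (X.act g U x) = X.act (h * g) U x := X.cj_cj _ _ _ _ _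

theorem act_congr {g h : G} {U : Subgroup G} (hgh : g⁻¹ * h ∈ U) (x : X.obj U) :
    X.act g U x = X.act h U x := by
  conv_lhs => rw [← X.act_of_mem hgh x, act_act, mul_inv_cancel_left]

theorem res_act (g : G) {U V : Subgroup G} (h : V ≤ U) (x : X.obj U) :
    X.res h (X.act g U x) = X.act g V (X.res h x) := X.res_cj g h _ _ x

theorem tr_act (g : G) {U V : Subgroup G} (h : V ≤ U) (x : X.obj V) :
    X.tr h (X.act g V x) = X.act g U (X.tr h x) := X.tr_cj g h _ _ x

theorem app_act {X Y : CohMackeyFunctor.{u, v, w} R G} (f : X ⟶ Y) (g : G) (U : Subgroup G)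
    (x : X.obj U) : Hom.app f U (X.act g U x) = Y.act g U (Hom.app f U x) := Hom.app_cj f g _ x

/-- As `G` is abelian and W ≤ V, the double coset VsW is the coset sV, so representatives of U/V
suffice. -/
theorem exists_isDoubleCosetReps [Finite G] {U V W : Subgroup G} (hWV : W ≤ V) :
    ∃ S : Finset G, IsDoubleCosetReps V U W S := by
  classical
  obtain ⟨ι, _, r, hr, hex, -⟩ := exists_reps U V
  refine ⟨Finset.univ.image r, by simpa using hr, fun x hx => ?_⟩
  obtain ⟨j, hj, hju⟩ := hex x hx
  refine ⟨r j, ⟨by simp, (r j)⁻¹ * x, hj, 1, W.one_mem, by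
    rw [mul_one, mul_comm' _ (r j), mul_inv_cancel_left]⟩, ?_⟩
  rintro s ⟨hs, a, ha, b, hb, rfl⟩
  obtain ⟨k, -, rfl⟩ := Finset.mem_image.1 hs
  rw [hju k]
  simp only
  rw [mul_comm' a, mul_assoc, inv_mul_cancel_left]
  exact V.mul_mem ha (hWV hb)

theorem res_tr_of_le {U V W : Subgroup G} (hWV : W ≤ V) (hVU : V ≤ U) {S : Finset G}
    (hS : IsDoubleCosetReps V U W S) (x : X.obj W) :
    X.res hVU (X.tr (hWV.trans hVU) x) = ∑ g ∈ S, X.tr hWV (X.act g W x) := by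
  -- The intersections in the Mackey formula equal `W` only propositionally; variables in their
  -- place can be substituted.
  have aux : ∀ (g : G) (V₁ V₂ : Subgroup G) (h₁ : V₁ ≤ W) (h : MulAut.conj g • V₁ = V₂)
      (h₂ : V₂ ≤ V), V₁ = W → X.tr h₂ (X.cj g h (X.res h₁ x)) = X.tr hWV (X.act g W x) := by
    rintro g V₁ V₂ h₁ h h₂ rfl
    obtain rfl : V₁ = V₂ := by rw [← h, conj_smul_eq_self]
    rw [res_self]
    rfl
  rw [X.mackey _ _ S hS]
  refine Finset.sum_congr rfl fun g _ => aux _ _ _ _ _ _ ?_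
  rw [conj_smul_eq_self, inf_eq_left]
  exact hWV

end Act

/-! ### The standard projectives represent evaluation -/

section Standard

open MonoidAlgebra (single)

variable [Finite G]

theorem permCoeff_smul {A : Type v} [MulAction G A] {U : Subgroup G} {u : G} (hu : u ∈ U) (a : A)
    (x : (permutation R (G := G) A).obj U) : permCoeff (u • a) x = permCoeff a x := by
  have h := (mem_fixedBy (Representation.ofMulAction R G A)).1
    (Subtype.prop (p := (· ∈ fixedBy _ U)) x) u hu
  have h2 := congrArg (fun y => y.coeff (u • a)) h
  simp only [Representation.coeff_ofMulAction, inv_smul_smul] at h2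
  exact h2.symm

variable [IsMulCommutative G] (W : Subgroup G)

theorem permCoeff_act {A : Type v} [MulAction G A] {U : Subgroup G} (g : G) (a : A)
    (x : (permutation R (G := G) A).obj U) :
    permCoeff a ((permutation R A).act g U x) = permCoeff (g⁻¹ • a) x :=
  Representation.coeff_ofMulAction _ _ _

-- Because W acts trivially on G/W, `gen` is a fixed point and R[G/W]^U is all of R[G/W] for U ≤ W.
omit [Finite G] in
theorem smul_coset_eq_self {g : G} (hg : g ∈ W) (q : G ⧸ W) : g • q = q := by
  induction q using QuotientGroup.induction_on with
  | H k =>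
    rw [MulAction.Quotient.smul_coe, QuotientGroup.eq, smul_eq_mul, mul_comm' g, mul_inv_rev,
      mul_assoc, inv_mul_cancel, mul_one]
    exact W.inv_mem hg

variable (R) in
/-- The canonical generator of `P^W`. -/
noncomputable def gen : (standardProjective R W).obj W :=
  (⟨single ((1 : G) : G ⧸ W) 1, (mem_fixedBy _).2 fun g hg => by
    rw [Representation.ofMulAction_single, smul_coset_eq_self W hg]⟩ :
    fixedBy (Representation.ofMulAction R G (G ⧸ W)) W)

variable {W} in
/-- The coefficient at `q` of an element of a value of `P^W`. -/
noncomputable def stdCoeff {U : Subgroup G} (q : G ⧸ W) :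
    (standardProjective R W).obj U →ₗ[R] R := permCoeff q

variable {W} in
omit [IsMulCommutative G] in
theorem stdCoeff_ext {U : Subgroup G} {x y : (standardProjective R W).obj U}
    (h : ∀ k : G, stdCoeff (k : G ⧸ W) x = stdCoeff (k : G ⧸ W) y) : x = y :=
  permCoeff_ext fun q => QuotientGroup.induction_on q h

open Classical in
theorem stdCoeff_act_gen (g k : G) :
    stdCoeff (k : G ⧸ W) ((standardProjective R W).act g W (gen R W)) =
      if g⁻¹ * k ∈ W then 1 else 0 := by
  refine (permCoeff_act _ _ _).trans ?_
  have : permCoeff (g⁻¹ • (k : G ⧸ W)) (gen R W) =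
    (single ((1 : G) : G ⧸ W) (1 : R)).coeff (g⁻¹ • (k : G ⧸ W)) := rfl
  rw [this, MonoidAlgebra.coeff_single, Finsupp.single_apply, MulAction.Quotient.smul_coe]
  congr 1
  rw [QuotientGroup.eq, inv_one, one_mul, smul_eq_mul]

-- The U/W-translates of gW run once through the cosets in gU, so this transfer is the indicator of
-- gU/W. These indicators, for g in G/U, form a basis of R[G/W]^U.
open Classical in
theorem stdCoeff_tr_act_gen {U : Subgroup G} (h : W ≤ U) (g k : G) :
    stdCoeff (k : G ⧸ W)
      ((standardProjective R W).tr h ((standardProjective R W).act g W (gen R W))) =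
      if g⁻¹ * k ∈ U then 1 else 0 := by
  obtain ⟨ι, _, r, hr, hex, -⟩ := exists_reps U W
  have h1 : ∀ z, stdCoeff (k : G ⧸ W) ((standardProjective R W).tr h z) =
      ∑ j, stdCoeff (((r j)⁻¹ * k : G) : G ⧸ W) z := by
    intro z
    have h2 := transfer_eq_sum (Representation.ofMulAction R G (G ⧸ W))
      (Subtype.prop (p := (· ∈ fixedBy _ W)) z) r hr hex
    refine (congrArg (fun y => y.coeff (k : G ⧸ W)) h2).trans ?_
    rw [MonoidAlgebra.coeff_sum, Finsupp.finsetSum_apply]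
    exact Finset.sum_congr rfl fun j _ => Representation.coeff_ofMulAction _ _ _
  have hc : ∀ j, g⁻¹ * ((r j)⁻¹ * k) = (r j)⁻¹ * (g⁻¹ * k) := fun j => by
    rw [← mul_assoc, mul_comm' g⁻¹, mul_assoc]
  simp only [h1, stdCoeff_act_gen, hc]
  split_ifs with hk
  · obtain ⟨j, hj, hju⟩ := hex _ hk
    rw [Finset.sum_eq_single j, if_pos hj]
    · intro i _ hi
      exact if_neg fun h' => hi (hju i h')
    · simp
  · refine Finset.sum_eq_zero fun j _ => if_neg fun h' => hk ?_
    simpa using U.mul_mem (hr j) (h h')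

theorem sum_act_gen [Fintype (G ⧸ W)] (z : (standardProjective R W).obj W) :
    z = ∑ q : G ⧸ W, stdCoeff q z • (standardProjective R W).act q.out W (gen R W) := by
  classical
  refine stdCoeff_ext fun k => ?_
  simp only [map_sum, map_smul, stdCoeff_act_gen]
  rw [Finset.sum_eq_single (k : G ⧸ W)]
  · rw [if_pos (QuotientGroup.eq.1 (QuotientGroup.out_eq' _)), smul_eq_mul, mul_one]
  · intro q _ hq
    rw [if_neg fun h => hq ((QuotientGroup.out_eq' q).symm.trans (QuotientGroup.eq.2 h)),
      smul_zero]
  · simp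

variable {W}

theorem linearMap_ext_gen {M : Type*} [AddCommGroup M] [Module R M]
    {f f' : (standardProjective R W).obj W →ₗ[R] M}
    (h : ∀ g, f ((standardProjective R W).act g W (gen R W)) =
      f' ((standardProjective R W).act g W (gen R W))) : f = f' := by
  have := Fintype.ofFinite (G ⧸ W)
  refine LinearMap.ext fun z => ?_
  rw [sum_act_gen W z, map_sum, map_sum]
  exact Finset.sum_congr rfl fun q _ => by rw [map_smul, map_smul, h]

theorem res_bijective {U : Subgroup G} (h : U ≤ W) :
    Function.Bijective ((standardProjective R W).res h) := by
  refine ⟨fun x y hxy => Subtype.ext (congrArg (Subtype.val (p := (· ∈ fixedBy _ U))) hxy),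
    fun y => ?_⟩
  exact ⟨(⟨(Subtype.val (p := (· ∈ fixedBy _ U)) y), (mem_fixedBy _).2 fun g hg => perm_ext fun q =>
    by rw [Representation.coeff_ofMulAction, smul_coset_eq_self W (W.inv_mem hg)]⟩ :
    fixedBy (Representation.ofMulAction R G (G ⧸ W)) W), rfl⟩

theorem tr_surjective {U : Subgroup G} (h : W ≤ U) :
    Function.Surjective ((standardProjective R W).tr h) := by
  classical
  have := Fintype.ofFinite (G ⧸ U)
  intro f
  -- Coefficients of `f` are constant on the cosets of U, so `f` is the combination of coset
  -- indicators weighted by its coefficients at representatives.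
  refine ⟨∑ c : G ⧸ U, stdCoeff ((c.out : G) : G ⧸ W) f •
    (standardProjective R W).act c.out W (gen R W), stdCoeff_ext fun k => ?_⟩
  simp only [map_sum, map_smul, stdCoeff_tr_act_gen]
  rw [Finset.sum_eq_single (k : G ⧸ U)]
  · have h1 : ((k : G ⧸ U).out)⁻¹ * k ∈ U := QuotientGroup.eq.1 (QuotientGroup.out_eq' _)
    have h2 := permCoeff_smul h1 (((k : G ⧸ U).out : G) : G ⧸ W) f
    rw [MulAction.Quotient.smul_coe, smul_eq_mul, mul_comm' _ (Quotient.out _),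
      mul_inv_cancel_left] at h2
    rw [if_pos h1, smul_eq_mul, mul_one]
    exact h2.symm
  · intro q _ hq
    rw [if_neg fun h => hq ((QuotientGroup.out_eq' q).symm.trans (QuotientGroup.eq.2 h)),
      smul_zero]
  · simp

/-- Homomorphisms out of `P^W` that agree on the generator agree. -/
theorem standardProjective_hom_ext (hc : ∀ U V : Subgroup G, U ≤ V ∨ V ≤ U)
    {X : CohMackeyFunctor.{u, v, max u v} R G} {f f' : standardProjective R W ⟶ X}
    (h : Hom.app f W (gen R W) = Hom.app f' W (gen R W)) : f = f' := by
  have hW : Hom.app f W = Hom.app f' W := linearMap_ext_gen fun g => by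
    rw [app_act, app_act, h]
  refine hom_ext fun U z => ?_
  obtain hU | hU := hc U W
  · obtain ⟨z, rfl⟩ := (res_bijective hU).2 z
    rw [Hom.app_res, Hom.app_res, hW]
  · obtain ⟨z, rfl⟩ := tr_surjective hU z
    rw [Hom.app_tr, Hom.app_tr, hW]

variable (X : CohMackeyFunctor.{u, v, max u v} R G)

/-- The `G`-equivariant map on the value at `W` sending the generator of `P^W` to `x`. -/
noncomputable def evalGen (x : X.obj W) : (standardProjective R W).obj W →ₗ[R] X.obj W :=
  letI := Fintype.ofFinite (G ⧸ W)
  ∑ q : G ⧸ W, (stdCoeff q).smulRight (X.act q.out W x)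

theorem evalGen_act_gen (x : X.obj W) (g : G) :
    evalGen X x ((standardProjective R W).act g W (gen R W)) = X.act g W x := by
  classical
  let _ := Fintype.ofFinite (G ⧸ W)
  rw [evalGen, LinearMap.sum_apply, Finset.sum_eq_single (g : G ⧸ W)]
  · rw [LinearMap.smulRight_apply, stdCoeff_act_gen, if_pos (by simp), one_smul]
    exact X.act_congr (QuotientGroup.eq.1 (QuotientGroup.out_eq' _)) x
  · intro q _ hq
    rw [LinearMap.smulRight_apply, ← QuotientGroup.out_eq' q, stdCoeff_act_gen, if_neg, zero_smul]
    exact fun h => hq ((QuotientGroup.out_eq' q).symm.trans (QuotientGroup.eq.2 h).symm)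
  · simp

theorem evalGen_act (x : X.obj W) (g : G) (z : (standardProjective R W).obj W) :
    evalGen X x ((standardProjective R W).act g W z) = X.act g W (evalGen X x z) := by
  have : evalGen X x ∘ₗ (standardProjective R W).act g W = X.act g W ∘ₗ evalGen X x :=
    linearMap_ext_gen fun h => by
      simp only [LinearMap.comp_apply, act_act, evalGen_act_gen]
  exact LinearMap.congr_fun this z

theorem exists_app_of_le (x : X.obj W) {U : Subgroup G} (h : U ≤ W) :
    ∃ φ : (standardProjective R W).obj U →ₗ[R] X.obj U,
      ∀ z, φ ((standardProjective R W).res h z) = X.res h (evalGen X x z) := by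
  refine ⟨X.res h ∘ₗ evalGen X x ∘ₗ
    (LinearEquiv.ofBijective _ (res_bijective (R := R) h)).symm.toLinearMap, fun z => ?_⟩
  exact congrArg (fun z => X.res h (evalGen X x z))
    ((LinearEquiv.ofBijective _ (res_bijective (R := R) h)).symm_apply_apply z)

/-- Transfer to U need not be injective, so it cannot be inverted as restriction was. Instead φ is
prescribed on the basis of coset indicators, cU going to c · tr x, and is then compared with
transfers of translates of `gen`. -/
theorem exists_app_of_ge (x : X.obj W) {U : Subgroup G} (h : W ≤ U) :
    ∃ φ : (standardProjective R W).obj U →ₗ[R] X.obj U,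
      ∀ z, φ ((standardProjective R W).tr h z) = X.tr h (evalGen X x z) := by
  classical
  let _ := Fintype.ofFinite (G ⧸ U)
  let φ : (standardProjective R W).obj U →ₗ[R] X.obj U :=
    ∑ c : G ⧸ U, (stdCoeff ((c.out : G) : G ⧸ W)).smulRight (X.act c.out U (X.tr h x))
  have : φ ∘ₗ (standardProjective R W).tr h = X.tr h ∘ₗ evalGen X x := by
    refine linearMap_ext_gen fun g => ?_
    rw [LinearMap.comp_apply, LinearMap.comp_apply, evalGen_act_gen, LinearMap.sum_apply,
      Finset.sum_eq_single (g : G ⧸ U)]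
    · have h1 : (g : G ⧸ U).out⁻¹ * g ∈ U := QuotientGroup.eq.1 (QuotientGroup.out_eq' _)
      rw [LinearMap.smulRight_apply, stdCoeff_tr_act_gen, if_pos, one_smul]
      · rw [tr_act]
        exact X.act_congr h1 _
      · simpa using U.inv_mem h1
    · intro q _ hq
      rw [LinearMap.smulRight_apply, stdCoeff_tr_act_gen, if_neg, zero_smul]
      exact fun h => hq ((QuotientGroup.out_eq' q).symm.trans (QuotientGroup.eq.2 h).symm)
    · simp
  exact ⟨φ, LinearMap.congr_fun this⟩

/-- Every element of `X_W` is the image of the generator under a homomorphism `P^W ⟶ X`. -/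
theorem exists_hom_standardProjective (hc : ∀ U V : Subgroup G, U ≤ V ∨ V ≤ U) (x : X.obj W) :
    ∃ f : standardProjective R W ⟶ X, Hom.app f W (gen R W) = x := by
  have : ∀ U, ∃ φ : (standardProjective R W).obj U →ₗ[R] X.obj U,
      (∀ (h : U ≤ W) z, φ ((standardProjective R W).res h z) = X.res h (evalGen X x z)) ∧
      (∀ (h : W ≤ U) z, φ ((standardProjective R W).tr h z) = X.tr h (evalGen X x z)) := by
    intro U
    by_cases hU : U ≤ W
    · obtain ⟨φ, hφ⟩ := exists_app_of_le X x hU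
      refine ⟨φ, fun h z => hφ z, fun h z => ?_⟩
      -- Both conditions apply when U = W, where restriction and transfer are the identity.
      obtain rfl : U = W := le_antisymm hU h
      have := hφ z
      rw [res_self, res_self] at this
      rw [tr_self, tr_self, this]
    · obtain ⟨φ, hφ⟩ := exists_app_of_ge X x ((hc U W).resolve_left hU)
      exact ⟨φ, fun h => absurd h hU, fun _ z => hφ z⟩
  choose φ hle hge using this
  have app_act : ∀ g U z, φ U ((standardProjective R W).act g U z) = X.act g U (φ U z) := by
    intro g U z
    obtain hU | hU := hc U W
    · obtain ⟨z, rfl⟩ := (res_bijective hU).2 z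
      rw [← res_act, hle, hle, evalGen_act, res_act]
    · obtain ⟨z, rfl⟩ := tr_surjective hU z
      rw [← tr_act, hge, hge, evalGen_act, tr_act]
  have res_le : ∀ {U V} (_ : U ≤ W) (h : V ≤ U) (z : (standardProjective R W).obj U),
      φ V ((standardProjective R W).res h z) = X.res h (φ U z) := by
    intro U V hU h z
    obtain ⟨z, rfl⟩ := (res_bijective hU).2 z
    rw [res_res, hle, hle, res_res]
  have res_ge : ∀ {U V} (_ : W ≤ V) (h : V ≤ U) (z : (standardProjective R W).obj U),
      φ V ((standardProjective R W).res h z) = X.res h (φ U z) := by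
    intro U V hV h z
    obtain ⟨z, rfl⟩ := tr_surjective (hV.trans h) z
    -- Above W every element is a transfer, and the Mackey formula turns its restriction into a sum
    -- of transfers from W.
    obtain ⟨S, hS⟩ := exists_isDoubleCosetReps (U := U) hV
    rw [res_tr_of_le _ hV h hS, hge, res_tr_of_le _ hV h hS, map_sum]
    exact Finset.sum_congr rfl fun g _ => by rw [hge, evalGen_act]
  have tr_le : ∀ {U V} (_ : U ≤ W) (h : V ≤ U) (z : (standardProjective R W).obj V),
      φ U ((standardProjective R W).tr h z) = X.tr h (φ V z) := by
    intro U V hU h z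
    obtain ⟨z, rfl⟩ := (res_bijective (h.trans hU)).2 z
    -- Below W every element is a restriction from W, so its transfer is multiplication by an index.
    rw [← res_res _ hU h, cohomological, res_le hU, X.cohomological, map_nsmul]
  have tr_ge : ∀ {U V} (_ : W ≤ V) (h : V ≤ U) (z : (standardProjective R W).obj V),
      φ U ((standardProjective R W).tr h z) = X.tr h (φ V z) := by
    intro U V hV h z
    obtain ⟨z, rfl⟩ := tr_surjective hV z
    rw [tr_tr, hge, hge, tr_tr]
  refine ⟨{
    app := φ
    app_res := fun {U V} h z => ?_
    app_tr := fun {U V} h z => ?_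
    app_cj := fun g U V h z => ?_ }, ?_⟩
  · obtain hU | hU := hc U W
    · exact res_le hU h z
    · obtain hV | hV := hc V W
      -- For V ≤ W ≤ U the restriction factors through W; transfers are treated in the same way
      -- below.
      · rw [← res_res _ hU hV, res_le le_rfl, res_ge le_rfl, res_res]
      · exact res_ge hV h z
  · obtain hU | hU := hc U W
    · exact tr_le hU h z
    · obtain hV | hV := hc V W
      · rw [← tr_tr _ hU hV, tr_ge le_rfl, tr_le le_rfl, tr_tr]
      · exact tr_ge hV h z
  · obtain rfl : U = V := by rw [← h, conj_smul_eq_self]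
    exact app_act g U z
  · have := hle W le_rfl (gen R W)
    rw [res_self, res_self] at this
    refine this.trans ?_
    have h1 := evalGen_act_gen X x 1
    rwa [act_of_mem _ W.one_mem, act_of_mem _ W.one_mem] at h1

/-- Lifting a map out of P^W along an epimorphism amounts to lifting the image of `gen` at W. -/
theorem projective_standardProjective (hc : ∀ U V : Subgroup G, U ≤ V ∨ V ≤ U) :
    Projective (standardProjective R W) where
  factors {E X} f e _ := by
    obtain ⟨y, hy⟩ := surjective_of_epi e W (Hom.app f W (gen R W))
    obtain ⟨φ, hφ⟩ := exists_hom_standardProjective E hc y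
    refine ⟨φ, standardProjective_hom_ext hc ?_⟩
    rw [comp_app, LinearMap.comp_apply, hφ, hy]

theorem projective_permutation (hc : ∀ U V : Subgroup G, U ≤ V ∨ V ≤ U) (A : Type v) [Finite A]
    [MulAction G A] : Projective (permutation R (G := G) A) := by
  obtain ⟨e, he⟩ := exists_equiv_sigma_quotient_stabilizer (G := G) A
  refine Projective.of_iso (permutationSigma R _ ≪≫ (permutationCongr R e he).symm)
    (projective_directSum _ fun o => projective_standardProjective hc)

end Standard

/-! ### The radical and Nakayama's lemma -/

section Nakayama

open IsLocalRing (maximalIdeal)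

/-- Writing T = (T - 1) + 1 with commuting summands, the p^n-th power is additive modulo p. -/
theorem exists_sub_one_pow_eq {A : Type*} [Ring A] {p : ℕ} (hp : p.Prime) {n : ℕ} {T : A}
    (hT : T ^ p ^ n = 1) : ∃ r, (T - 1) ^ p ^ n = p * r := by
  obtain ⟨r, hr⟩ := (Commute.one_right (T - 1)).exists_add_pow_prime_pow_eq hp n
  rw [sub_add_cancel, hT, one_pow] at hr
  refine ⟨-((T - 1) * 1 * r), ?_⟩
  have : (T - 1) ^ p ^ n + p * ((T - 1) * 1 * r) = 0 := by
    simpa [add_assoc, add_comm, add_left_comm, mul_assoc] using hr.symm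
  rw [mul_neg, eq_neg_iff_add_eq_zero, this]

variable [IsLocalRing R]

/-- With Q = N + 𝔪M stable under T - 1, iterating M = Q + (T - 1)M gives M = Q + (T - 1)^k M for all
k. As T - 1 is nilpotent modulo p, M = Q, and the usual Nakayama lemma applies. -/
theorem eq_top_of_sup_range_sub_one_eq_top {M : Type*} [AddCommGroup M] [Module R M]
    [Module.Finite R M] {p : ℕ} (hp : p.Prime) (hpR : (p : R) ∈ maximalIdeal R) {n : ℕ}
    {T : Module.End R M} (hT : T ^ p ^ n = 1) {N : Submodule R M} (hN : ∀ x ∈ N, T x ∈ N)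
    (h : N ⊔ maximalIdeal R • ⊤ ⊔ LinearMap.range (T - 1) = ⊤) : N = ⊤ := by
  set Q := N ⊔ maximalIdeal R • (⊤ : Submodule R M) with hQ
  have hQT : Q ≤ Q.comap (T - 1) := by
    refine sup_le (fun x hx => ?_) (Submodule.smul_le.2 fun r hr x _ => ?_)
    · exact Submodule.mem_sup_left (N.sub_mem (hN x hx) hx)
    · rw [Submodule.mem_comap, map_smul]
      exact Submodule.mem_sup_right (Submodule.smul_mem_smul hr trivial)
  have hpow : ∀ k, ∀ x, x ∈ Q ⊔ LinearMap.range ((T - 1) ^ k) := by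
    intro k
    induction k with
    | zero => exact fun x => Submodule.mem_sup_right ⟨x, rfl⟩
    | succ k ih =>
      intro x
      obtain ⟨q, hq, _, ⟨y, rfl⟩, rfl⟩ := Submodule.mem_sup.1 (h.ge (trivial : x ∈ ⊤))
      obtain ⟨q', hq', _, ⟨z, rfl⟩, rfl⟩ := Submodule.mem_sup.1 (ih y)
      rw [map_add, ← add_assoc]
      refine Submodule.add_mem_sup (Q.add_mem hq (hQT hq')) ⟨z, ?_⟩
      rw [pow_succ', Module.End.mul_apply]
  obtain ⟨r, hr⟩ := exists_sub_one_pow_eq hp hT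
  have hQ' : Q = ⊤ := by
    refine eq_top_iff.2 fun x _ => ?_
    have h2 : LinearMap.range ((T - 1) ^ p ^ n) ≤ Q := by
      rintro _ ⟨y, rfl⟩
      rw [hr, Module.End.mul_apply, Module.End.natCast_apply, ← Nat.cast_smul_eq_nsmul R]
      exact Submodule.mem_sup_right (Submodule.smul_mem_smul hpR trivial)
    exact (sup_le le_rfl h2) (hpow _ x)
  exact top_le_iff.1 (Submodule.le_of_le_smul_of_le_jacobson_bot Module.Finite.fg_top
    (IsLocalRing.maximalIdeal_le_jacobson _) hQ'.ge)

variable [IsMulCommutative G]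

/-- The radical of a value of a Mackey functor over a local ring, for an abelian group generated
by `g₀`. -/
def rad (X : CohMackeyFunctor.{u, v, w} R G) (g₀ : G) (U : Subgroup G) : Submodule R (X.obj U) :=
  maximalIdeal R • ⊤ ⊔ LinearMap.range (X.act g₀ U - 1) ⊔
    (⨆ (V : Subgroup G) (h : V < U), LinearMap.range (X.tr h.le)) ⊔
    ⨆ (V : Subgroup G) (h : U < V), LinearMap.range (X.res h.le)

section

variable (X : CohMackeyFunctor.{u, v, w} R G) {g₀ : G} {U V : Subgroup G}

theorem smul_mem_rad {r : R} (hr : r ∈ maximalIdeal R) (x : X.obj U) : r • x ∈ X.rad g₀ U :=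
  Submodule.mem_sup_left (Submodule.mem_sup_left (Submodule.mem_sup_left
    (Submodule.smul_mem_smul hr trivial)))

theorem act_sub_mem_rad (x : X.obj U) : X.act g₀ U x - x ∈ X.rad g₀ U :=
  Submodule.mem_sup_left (Submodule.mem_sup_left (Submodule.mem_sup_right ⟨x, rfl⟩))

theorem tr_mem_rad (h : V < U) (x : X.obj V) : X.tr h.le x ∈ X.rad g₀ U :=
  Submodule.mem_sup_left (Submodule.mem_sup_right
    (Submodule.mem_iSup_of_mem V (Submodule.mem_iSup_of_mem h ⟨x, rfl⟩)))

theorem res_mem_rad (h : U < V) (x : X.obj V) : X.res h.le x ∈ X.rad g₀ U :=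
  Submodule.mem_sup_right
    (Submodule.mem_iSup_of_mem V (Submodule.mem_iSup_of_mem h ⟨x, rfl⟩))

theorem app_mem_rad {X Y : CohMackeyFunctor.{u, v, w} R G} (f : X ⟶ Y) {x : X.obj U}
    (hx : x ∈ X.rad g₀ U) : Hom.app f U x ∈ Y.rad g₀ U := by
  suffices h : X.rad g₀ U ≤ (Y.rad g₀ U).comap (Hom.app f U) from h hx
  refine sup_le (sup_le (sup_le (Submodule.smul_le.2 fun r hr x _ => ?_) ?_)
    (iSup₂_le fun V hV => ?_)) (iSup₂_le fun V hV => ?_)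
  · rw [Submodule.mem_comap, map_smul]
    exact smul_mem_rad Y hr _
  · rintro _ ⟨x, rfl⟩
    rw [Submodule.mem_comap, LinearMap.sub_apply, map_sub, app_act]
    exact act_sub_mem_rad Y _
  · rintro _ ⟨x, rfl⟩
    rw [Submodule.mem_comap, Hom.app_tr]
    exact tr_mem_rad Y hV _
  · rintro _ ⟨x, rfl⟩
    rw [Submodule.mem_comap, Hom.app_res]
    exact res_mem_rad Y hV _

end

omit [IsMulCommutative G] in
theorem natCast_relIndex_mem [Finite G] {p : ℕ} (hp : p.Prime) (hpR : (p : R) ∈ maximalIdeal R)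
    {n : ℕ} (hG : Nat.card G = p ^ n) {U V : Subgroup G} (h : V < U) :
    (V.relIndex U : R) ∈ maximalIdeal R := by
  have h1 : V.relIndex U ∣ p ^ n := hG ▸ (Subgroup.relIndex_dvd_card V U).trans
    (Subgroup.card_subgroup_dvd_card U)
  obtain ⟨k, -, hk⟩ := (Nat.dvd_prime_pow hp).1 h1
  rw [hk]
  cases k with
  | zero => exact absurd (Subgroup.relIndex_eq_one.1 (by simpa using hk)) h.not_ge
  | succ k =>
    rw [pow_succ, Nat.cast_mul]
    exact Ideal.mul_mem_left _ _ hpR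

omit [IsLocalRing R] in
theorem act_pow (X : CohMackeyFunctor.{u, v, w} R G) (g : G) (U : Subgroup G) (k : ℕ) :
    X.act g U ^ k = X.act (g ^ k) U := by
  induction k with
  | zero =>
    ext x
    rw [pow_zero, pow_zero, act_of_mem _ U.one_mem]
    rfl
  | succ k ih =>
    ext x
    rw [pow_succ, pow_succ, ih, Module.End.mul_apply, act_act]

/-- Nakayama's lemma for Mackey functors of cyclic `p`-groups. -/
theorem eq_top_of_sup_rad_eq_top [Finite G] {p : ℕ} (hp : p.Prime)
    (hpR : (p : R) ∈ maximalIdeal R) {n : ℕ} (hG : Nat.card G = p ^ n)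
    (hc : ∀ U V : Subgroup G, U ≤ V ∨ V ≤ U) (g₀ : G)
    (X : CohMackeyFunctor.{u, v, w} R G) (hX : ∀ U, Module.Finite R (X.obj U))
    (N : ∀ U, Submodule R (X.obj U))
    (hres : ∀ {U V : Subgroup G} (h : V ≤ U), N U ≤ (N V).comap (X.res h))
    (htr : ∀ {U V : Subgroup G} (h : V ≤ U), N V ≤ (N U).comap (X.tr h))
    (hact : ∀ U, N U ≤ (N U).comap (X.act g₀ U))
    (h : ∀ U, N U ⊔ X.rad g₀ U = ⊤) (U : Subgroup G) : N U = ⊤ := by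
  -- `Q` adds to `N` the part of the radical internal to U. It is stable under restriction and
  -- transfer, and the other two parts are removed one after the other.
  let Q : ∀ U, Submodule R (X.obj U) := fun U =>
    N U ⊔ maximalIdeal R • ⊤ ⊔ LinearMap.range (X.act g₀ U - 1)
  have hmQ : ∀ (U) {r : R} (_ : r ∈ maximalIdeal R) (x : X.obj U), r • x ∈ Q U :=
    fun U r hr x => Submodule.mem_sup_left (Submodule.mem_sup_right
      (Submodule.smul_mem_smul hr trivial))
  have hiQ : ∀ {U V : Subgroup G} (_ : V < U) (x : X.obj U), V.relIndex U • x ∈ Q U := by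
    intro U V hV x
    rw [← Nat.cast_smul_eq_nsmul R]
    exact hmQ U (natCast_relIndex_mem hp hpR hG hV) x
  have resQ : ∀ {U V : Subgroup G} (h : V ≤ U), Q U ≤ (Q V).comap (X.res h) := by
    intro U V h
    refine sup_le (sup_le (fun x hx => ?_) (Submodule.smul_le.2 fun r hr x _ => ?_)) ?_
    · exact Submodule.mem_sup_left (Submodule.mem_sup_left (hres h hx))
    · rw [Submodule.mem_comap, map_smul]
      exact hmQ V hr _
    · rintro _ ⟨x, rfl⟩
      rw [Submodule.mem_comap, LinearMap.sub_apply, map_sub, res_act]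
      exact Submodule.mem_sup_right ⟨X.res h x, rfl⟩
  have trQ : ∀ {U V : Subgroup G} (h : V ≤ U), Q V ≤ (Q U).comap (X.tr h) := by
    intro U V h
    refine sup_le (sup_le (fun x hx => ?_) (Submodule.smul_le.2 fun r hr x _ => ?_)) ?_
    · exact Submodule.mem_sup_left (Submodule.mem_sup_left (htr h hx))
    · rw [Submodule.mem_comap, map_smul]
      exact hmQ U hr _
    · rintro _ ⟨x, rfl⟩
      rw [Submodule.mem_comap, LinearMap.sub_apply, map_sub, tr_act]
      exact Submodule.mem_sup_right ⟨X.tr h x, rfl⟩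
  -- As U and V' are comparable, such a composite contains a restriction followed by its own
  -- transfer, hence a proper index.
  have tr_res_mem : ∀ {U V V' : Subgroup G} (h1 : V < U) (h2 : V < V') (x : X.obj V'),
      X.tr h1.le (X.res h2.le x) ∈ Q U := by
    intro U V V' h1 h2 x
    obtain h3 | h3 := hc V' U
    · rw [← X.tr_tr h3 h2.le, cohomological]
      exact trQ h3 (hiQ h2 x)
    · rw [← X.res_res h3 h1.le, cohomological]
      exact hiQ h1 _
  -- Upward induction removes the transfers: by hypothesis X_V is `Q V` plus restrictions, and both
  -- transfer into `Q U`.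
  have step1 : ∀ U, Q U ⊔ (⨆ (V : Subgroup G) (h : U < V), LinearMap.range (X.res h.le)) = ⊤ := by
    intro U
    induction U using WellFoundedLT.induction with
    | ind U ih =>
      rw [eq_top_iff, ← h U]
      refine sup_le (le_sup_of_le_left (le_sup_of_le_left le_sup_left)) (sup_le (sup_le (sup_le
        (le_sup_of_le_left (le_sup_of_le_left le_sup_right)) (le_sup_of_le_left le_sup_right))
        (iSup₂_le fun V hV => le_sup_of_le_left ?_)) le_sup_right)
      rw [LinearMap.range_eq_map, ← ih V hV, Submodule.map_le_iff_le_comap]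
      refine sup_le (trQ hV.le) (iSup₂_le fun V' hV' => ?_)
      rintro _ ⟨x, rfl⟩
      exact tr_res_mem hV hV' x
  -- Downward induction removes the restrictions.
  have step2 : ∀ U, Q U = ⊤ := by
    intro U
    induction U using WellFoundedGT.induction with
    | ind U ih =>
      rw [eq_top_iff, ← step1 U]
      refine sup_le le_rfl (iSup₂_le fun V hV => ?_)
      rw [LinearMap.range_eq_map, ← ih V hV, Submodule.map_le_iff_le_comap]
      exact resQ hV.le
  have := hX U
  refine eq_top_of_sup_range_sub_one_eq_top hp hpR (n := n) (T := X.act g₀ U) ?_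
    (fun x hx => hact U hx) (step2 U)
  rw [act_pow, ← hG, pow_card_eq_one']
  ext x
  exact act_of_mem _ U.one_mem x

end Nakayama

/-! ### Projective lattice functors are sums of standard projectives -/

section KrullSchmidt

open IsLocalRing (maximalIdeal)

variable [IsLocalRing R]

/-- A minimal system of generators modulo a submodule is independent modulo that submodule and
the maximal ideal. -/
theorem exists_minimal_generators {M : Type*} [AddCommGroup M] [Module R M] [Module.Finite R M]
    (N : Submodule R M) : ∃ (m : ℕ) (x : Fin m → M), Submodule.span R (Set.range x) ⊔ N = ⊤ ∧
      ∀ a : Fin m → R, ∑ j, a j • x j ∈ N → ∀ j, a j ∈ maximalIdeal R := by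
  classical
  have hex : ∃ m, ∃ x : Fin m → M, Submodule.span R (Set.range x) ⊔ N = ⊤ := by
    obtain ⟨m, x, hx⟩ := Module.Finite.exists_fin (R := R) (M := M)
    exact ⟨m, x, by rw [hx, top_sup_eq]⟩
  obtain ⟨x, hx⟩ := Nat.find_spec hex
  refine ⟨_, x, hx, fun a ha j => ?_⟩
  -- A unit coefficient would allow `x j` to be expressed by the other generators modulo `N`,
  -- against the minimality of the number of generators.
  by_contra hj
  have hu : IsUnit (a j) := by simpa using hj
  obtain ⟨b, hb⟩ := hu.exists_left_inv
  generalize hm : Nat.find hex = m at *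
  cases m with
  | zero => exact j.elim0
  | succ m =>
    refine Nat.find_min hex (hm ▸ Nat.lt_succ_self m) ⟨fun k => x (j.succAbove k), ?_⟩
    have hmem : ∀ k, x (j.succAbove k) ∈
        Submodule.span R (Set.range fun k => x (j.succAbove k)) ⊔ N :=
      fun k => Submodule.mem_sup_left (Submodule.subset_span ⟨k, rfl⟩)
    rw [eq_top_iff, ← hx]
    refine sup_le (Submodule.span_le.2 ?_) le_sup_right
    rintro _ ⟨i, rfl⟩
    obtain rfl | ⟨k, rfl⟩ := Fin.eq_self_or_eq_succAbove j i
    · have h1 : x i = b • ∑ k, a k • x k - ∑ k, (b * a (i.succAbove k)) • x (i.succAbove k) := by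
        rw [Fin.sum_univ_succAbove _ i, smul_add, Finset.smul_sum, smul_smul, hb, one_smul]
        simp only [smul_smul, add_sub_cancel_right]
      rw [h1]
      exact Submodule.sub_mem _ (Submodule.mem_sup_right (N.smul_mem _ ha))
        (Submodule.sum_mem _ fun k _ => Submodule.smul_mem _ _ (hmem k))
    · exact hmem k

variable [IsMulCommutative G] {g₀ : G}

theorem act_sub_self_mem_rad (hg₀ : ∀ g, g ∈ Submonoid.powers g₀)
    (X : CohMackeyFunctor.{u, v, w} R G) (g : G) {U : Subgroup G} (x : X.obj U) :
    X.act g U x - x ∈ X.rad g₀ U := by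
  obtain ⟨k, rfl⟩ := hg₀ g
  induction k with
  | zero => simp [act_of_mem _ U.one_mem]
  | succ k ih =>
    simp only at ih ⊢
    rw [pow_succ', ← act_act, ← sub_add_sub_cancel _ (X.act (g₀ ^ k) U x)]
    exact Submodule.add_mem _ (act_sub_mem_rad X _) ih

variable [Finite G]

/-- Away from W, every value of P^W consists of restrictions or transfers from W; only the value at
W can survive modulo the radical. -/
theorem mem_rad_standardProjective_of_ne (hc : ∀ U V : Subgroup G, U ≤ V ∨ V ≤ U)
    {U W : Subgroup G} (h : U ≠ W) (z : (standardProjective R W).obj U) :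
    z ∈ (standardProjective R W).rad g₀ U := by
  obtain hU | hU := hc U W
  · obtain ⟨z, rfl⟩ := (res_bijective hU).2 z
    exact res_mem_rad _ (lt_of_le_of_ne hU h) z
  · obtain ⟨z, rfl⟩ := tr_surjective hU z
    exact tr_mem_rad _ (lt_of_le_of_ne hU h.symm) z

theorem exists_sub_smul_gen_mem_rad (hg₀ : ∀ g, g ∈ Submonoid.powers g₀) {W : Subgroup G}
    (z : (standardProjective R W).obj W) :
    ∃ ε : R, z - ε • gen R W ∈ (standardProjective R W).rad g₀ W := by
  have := Fintype.ofFinite (G ⧸ W)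
  -- All translates of `gen` agree modulo the radical, so ε is the augmentation of `z`.
  refine ⟨∑ q : G ⧸ W, stdCoeff q z, ?_⟩
  conv => enter [2, 1]; rw [sum_act_gen W z]
  rw [Finset.sum_smul, ← Finset.sum_sub_distrib]
  refine Submodule.sum_mem _ fun q _ => ?_
  rw [← smul_sub]
  exact Submodule.smul_mem _ _ (act_sub_self_mem_rad hg₀ _ _ _)

variable (R) in
/-- The direct sum of `f W` copies of each `P^W`. -/
noncomputable abbrev standardSum (f : Subgroup G → ℕ) : CohMackeyFunctor.{u, v, max u v} R G :=
  directSum (fun j : (Σ W : Subgroup G, Fin (f W)) => standardProjective R j.1)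

omit [IsLocalRing R] [IsMulCommutative G] in
theorem finite_standardSum_obj [IsDomain R] [IsPrincipalIdealRing R] (f : Subgroup G → ℕ)
    (U : Subgroup G) : Module.Finite R ((standardSum R f).obj U) := by
  have := fun j : (Σ W : Subgroup G, Fin (f W)) =>
    (isLattice_permutation (R := R) (G := G) (G ⧸ j.1) U).1
  exact inferInstanceAs (Module.Finite R
    (∀ j : (Σ W : Subgroup G, Fin (f W)), (permutation R (G ⧸ j.1)).obj U))

section

variable {P : CohMackeyFunctor.{u, v, max u v} R G} {f : Subgroup G → ℕ}
  {x : ∀ W, Fin (f W) → P.obj W}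
  {φ : ∀ j : (Σ W : Subgroup G, Fin (f W)), standardProjective R j.1 ⟶ P}
  (hφ : ∀ j, Hom.app (φ j) j.1 (gen R j.1) = x j.1 j.2)

include hφ

/-- If the generators are independent modulo the radical, only elements of the radical are mapped
to the radical. -/
theorem mem_rad_of_desc_mem_rad (hc : ∀ U V : Subgroup G, U ≤ V ∨ V ≤ U)
    (hg₀ : ∀ g, g ∈ Submonoid.powers g₀)
    (hind : ∀ W (a : Fin (f W) → R), ∑ k, a k • x W k ∈ P.rad g₀ W → ∀ k, a k ∈ maximalIdeal R)
    {U : Subgroup G} {z : (standardSum R f).obj U}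
    (hz : Hom.app (directSum.desc _ φ) U z ∈ P.rad g₀ U) : z ∈ (standardSum R f).rad g₀ U := by
  classical
  have := Fintype.ofFinite (Subgroup G)
  choose ε hε using fun k : Fin (f U) =>
    exists_sub_smul_gen_mem_rad hg₀ (Hom.app (directSum.proj _ ⟨U, k⟩) U z)
  -- Modulo the radical, only the summands with W = U contribute to the image of `z`, each through
  -- its ε.
  have hsum : ∑ k, ε k • x U k ∈ P.rad g₀ U := by
    rw [← Submodule.Quotient.mk_eq_zero, ← Submodule.mkQ_apply] at hz ⊢
    rw [← hz, directSum.desc_app, map_sum, map_sum, Fintype.sum_sigma,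
      Fintype.sum_eq_single U]
    · refine Finset.sum_congr rfl fun k _ => ?_
      refine ((Submodule.Quotient.eq _).2 ?_).symm
      have := app_mem_rad (φ ⟨U, k⟩) (hε k)
      rwa [map_sub, map_smul, hφ ⟨U, k⟩] at this
    · intro W hW
      refine Finset.sum_eq_zero fun k _ => (Submodule.Quotient.mk_eq_zero _).2 ?_
      exact app_mem_rad _ (mem_rad_standardProjective_of_ne hc hW.symm _)
  have hproj : ∀ j, Hom.app (directSum.proj _ j) U z ∈ (standardProjective R j.1).rad g₀ U := by
    rintro ⟨W, k⟩
    by_cases hW : U = W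
    · subst hW
      have := Submodule.add_mem _ (hε k) (smul_mem_rad _ (hind U ε hsum k) (gen R U))
      rwa [sub_add_cancel] at this
    · exact mem_rad_standardProjective_of_ne hc hW _
  rw [← directSum.sum_incl _ U z]
  exact Submodule.sum_mem _ fun j _ => app_mem_rad _ (hproj j)

/-- The image is a subfunctor containing generators modulo the radical, so Nakayama applies. -/
theorem desc_surjective {p : ℕ} (hp : p.Prime)
    (hpR : (p : R) ∈ maximalIdeal R) {n : ℕ} (hG : Nat.card G = p ^ n)
    (hc : ∀ U V : Subgroup G, U ≤ V ∨ V ≤ U) (hP : ∀ U, Module.Finite R (P.obj U))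
    (hx : ∀ W, Submodule.span R (Set.range (x W)) ⊔ P.rad g₀ W = ⊤) (U : Subgroup G) :
    Function.Surjective (Hom.app (directSum.desc _ φ) U) := by
  rw [← LinearMap.range_eq_top]
  refine eq_top_of_sup_rad_eq_top hp hpR hG hc g₀ P hP
    (fun U => LinearMap.range (Hom.app (directSum.desc _ φ) U)) ?_ ?_ ?_ (fun U => ?_) U
  · rintro U V h _ ⟨z, rfl⟩
    exact ⟨_, Hom.app_res (directSum.desc _ φ) h z⟩
  · rintro U V h _ ⟨z, rfl⟩
    exact ⟨_, Hom.app_tr (directSum.desc _ φ) h z⟩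
  · rintro U _ ⟨z, rfl⟩
    exact ⟨_, app_act (directSum.desc _ φ) g₀ U z⟩
  · rw [eq_top_iff, ← hx U]
    refine sup_le_sup_right (Submodule.span_le.2 ?_) _
    rintro _ ⟨k, rfl⟩
    exact ⟨_, (directSum.desc_incl _ φ ⟨U, k⟩ U (gen R U)).trans (hφ ⟨U, k⟩)⟩

end

/-- A projective lattice functor of a cyclic `p`-group is a direct sum of standard projectives. -/
theorem exists_iso_standardSum [IsDomain R] [IsPrincipalIdealRing R] {p : ℕ} (hp : p.Prime)
    (hpR : (p : R) ∈ maximalIdeal R) {n : ℕ} (hG : Nat.card G = p ^ n)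
    (hc : ∀ U V : Subgroup G, U ≤ V ∨ V ≤ U) (hg₀ : ∀ g, g ∈ Submonoid.powers g₀)
    (P : CohMackeyFunctor.{u, v, max u v} R G) (hP : Projective P) (hL : P.IsLattice) :
    ∃ f : Subgroup G → ℕ, Nonempty (P ≅ standardSum R f) := by
  have hfin := fun U => (hL U).1
  choose f x hx hind using fun U => exists_minimal_generators (P.rad g₀ U)
  choose φ hφ using fun j : (Σ W : Subgroup G, Fin (f W)) =>
    exists_hom_standardProjective P hc (x j.1 j.2)
  have hsurj := desc_surjective (g₀ := g₀) hφ hp hpR hG hc hfin hx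
  have hepi : Epi (directSum.desc _ φ) := epi_of_surjective _ hsurj
  have hs := fun U y => congr_app (Projective.factorThru_comp (𝟙 P) (directSum.desc _ φ)) U y
  simp only [comp_app, LinearMap.comp_apply, id_app, LinearMap.id_apply] at hs
  generalize Projective.factorThru (𝟙 P) (directSum.desc _ φ) = s at hs
  -- The difference between `z` and `s` of its image lies in the kernel, hence in the radical, so
  -- the image of `s` is everything modulo the radical. A surjective section then forces
  -- injectivity.
  have hs_surj : ∀ U, Function.Surjective (Hom.app s U) := by
    intro U
    rw [← LinearMap.range_eq_top]
    refine eq_top_of_sup_rad_eq_top hp hpR hG hc g₀ _ (finite_standardSum_obj f)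
      (fun U => LinearMap.range (Hom.app s U)) ?_ ?_ ?_ (fun U => eq_top_iff.2 fun z _ => ?_) U
    · rintro U V h _ ⟨z, rfl⟩
      exact ⟨_, Hom.app_res s h z⟩
    · rintro U V h _ ⟨z, rfl⟩
      exact ⟨_, Hom.app_tr s h z⟩
    · rintro U _ ⟨z, rfl⟩
      exact ⟨_, app_act s g₀ U z⟩
    · rw [← add_sub_cancel (Hom.app s U (Hom.app (directSum.desc _ φ) U z)) z]
      refine Submodule.add_mem_sup ⟨_, rfl⟩ (mem_rad_of_desc_mem_rad hφ hc hg₀ hind ?_)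
      rw [map_sub, hs, sub_self]
      exact Submodule.zero_mem _
  refine ⟨f, ⟨(isoOfBijective (directSum.desc _ φ) fun U => ⟨fun a b hab => ?_, hsurj U⟩).symm⟩⟩
  obtain ⟨a, rfl⟩ := hs_surj U a
  obtain ⟨b, rfl⟩ := hs_surj U b
  rw [hs, hs] at hab
  rw [hab]

end KrullSchmidt

end CohMackeyFunctor

/-! ### Subgroups of cyclic p-groups and the rank matrix -/

section CyclicPGroup

variable {G : Type v} [Group G] [Finite G] [IsCyclic G]

/-- In a cyclic group x^d = 1 has at most d solutions, so a subgroup of order d is the full solution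
set. -/
theorem IsCyclic.subgroup_eq_of_card_eq {U V : Subgroup G} (h : Nat.card U = Nat.card V) :
    U = V := by
  classical
  have := Fintype.ofFinite G
  have key : ∀ {U : Subgroup G}, (U : Set G) = {x : G | x ^ Nat.card U = 1} := by
    intro U
    refine Set.eq_of_subset_of_ncard_le (fun x hx => ?_) ?_ (Set.toFinite _)
    · have := pow_card_eq_one' (x := (⟨x, hx⟩ : U))
      exact congrArg Subtype.val this
    · have h1 := IsCyclic.card_pow_eq_one_le (α := G) (n := Nat.card U) Nat.card_pos
      have h2 : {x : G | x ^ Nat.card U = 1}.ncard ≤ Nat.card U := by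
        rw [Set.ncard_eq_toFinset_card']
        convert h1 using 2
        ext
        simp
      exact h2
  apply SetLike.coe_injective
  rw [key, h, ← key]

/-- For a generator g take H i = ⟨g^(p^i)⟩; indexing by the exponent of the index makes the chain
decreasing. -/
theorem IsCyclic.exists_equiv_subgroup {p : ℕ} (hp : p.Prime) {n : ℕ} (hG : Nat.card G = p ^ n) :
    ∃ H : Fin (n + 1) ≃ Subgroup G, (∀ i j, i ≤ j → H j ≤ H i) ∧
      ∀ i, (H i).index = p ^ (i : ℕ) := by
  obtain ⟨g, hg⟩ := IsCyclic.exists_generator (α := G)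
  have hog : orderOf g = p ^ n := by
    rw [← hG, orderOf_eq_card_of_forall_mem_zpowers hg]
  have hcard : ∀ i : Fin (n + 1), Nat.card (Subgroup.zpowers (g ^ p ^ (i : ℕ))) = p ^ (n - i) := by
    intro i
    rw [Nat.card_zpowers, orderOf_pow_of_dvd (pow_pos hp.pos _).ne'
      (hog ▸ pow_dvd_pow p (Nat.lt_succ_iff.1 i.2)), hog,
      Nat.pow_div (Nat.lt_succ_iff.1 i.2) hp.pos]
  have hindex : ∀ i : Fin (n + 1),
      (Subgroup.zpowers (g ^ p ^ (i : ℕ))).index = p ^ (i : ℕ) := by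
    intro i
    have h1 := Subgroup.card_mul_index (Subgroup.zpowers (g ^ p ^ (i : ℕ)))
    rw [hcard, hG] at h1
    refine Nat.eq_of_mul_eq_mul_left (pow_pos hp.pos (n - i)) ?_
    rw [h1, ← pow_add, Nat.sub_add_cancel (Nat.lt_succ_iff.1 i.2)]
  refine ⟨Equiv.ofBijective (fun i : Fin (n + 1) => Subgroup.zpowers (g ^ p ^ (i : ℕ)))
    ⟨fun i j hij => ?_, fun U => ?_⟩, fun i j hij => ?_, hindex⟩
  · have := congrArg Subgroup.index hij
    simp only [hindex] at this
    exact Fin.ext (Nat.pow_right_injective hp.two_le this :)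
  · obtain ⟨m, hm, hU⟩ := (Nat.dvd_prime_pow hp).1 (hG ▸ Subgroup.card_subgroup_dvd_card U)
    refine ⟨⟨n - m, by omega⟩, IsCyclic.subgroup_eq_of_card_eq ?_⟩
    rw [hcard, hU]
    congr 1
    simp only
    omega
  · refine Subgroup.zpowers_le.2 ?_
    obtain ⟨k, hk⟩ := pow_dvd_pow p (show (i : ℕ) ≤ j from hij)
    rw [hk, pow_mul]
    exact Subgroup.npow_mem_zpowers _ _

end CyclicPGroup

/-- The last two rows of the matrix f(min(i,j)) differ only in the last column, by f(n+1) - f(n) ≠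
0. This kills the last unknown and leaves the smaller system. -/
theorem eq_zero_of_sum_mul_min {f : ℕ → ℤ} (hf : StrictMono f) (h0 : f 0 ≠ 0) (n : ℕ)
    (a : Fin (n + 1) → ℤ) (h : ∀ i : Fin (n + 1), ∑ j, a j * f (min (i : ℕ) j) = 0) : a = 0 := by
  induction n with
  | zero =>
    ext i
    obtain rfl : i = 0 := Fin.fin_one_eq_zero i
    simpa [h0] using h 0
  | succ n ih =>
    have hlast : a (Fin.last _) = 0 := by
      have h1 := h (Fin.last _)
      have h2 := h (Fin.last n).castSucc
      rw [Fin.sum_univ_castSucc] at h1 h2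
      have h3 : ∀ j : Fin (n + 1), min n (j : ℕ) = j := fun j => by omega
      have h4 : ∀ j : Fin (n + 1), min (n + 1) (j : ℕ) = j := fun j => by omega
      simp only [Fin.val_last, Fin.val_castSucc, h3, h4, min_self,
        min_eq_left (Nat.le_succ n)] at h1 h2
      have h5 : a (Fin.last _) * (f (n + 1) - f n) = 0 := by linear_combination h1 - h2
      exact (mul_eq_zero.1 h5).resolve_right (sub_ne_zero.2 (hf (Nat.lt_succ_self n)).ne')
    have h6 := ih (fun i => a i.castSucc) fun i => by
      have := h i.castSucc
      rwa [Fin.sum_univ_castSucc, hlast, zero_mul, add_zero] at this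
    ext i
    refine Fin.lastCases hlast (fun i => ?_) i
    exact congrFun h6 i

/-! ### Generators and additive invariants of the Burnside ring -/

namespace BurnsideRing

open FiniteGSet

variable {G : Type v} [Group G]

theorem mk_eq_of_iso {X Y : FiniteGSet G} (h : Iso X Y) : mk X = mk Y := by
  have : isoClass X = isoClass Y := Quotient.sound h
  rw [mk, mk, this]

theorem mk_sum (X Y : FiniteGSet G) : mk (sum X Y) = mk X + mk Y := by
  rw [← sub_eq_zero, ← sub_sub]
  exact Ideal.Quotient.eq_zero_iff_mem.2 (Ideal.subset_span ⟨X, Y, rfl⟩)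

theorem single_eq_smul_of {M : Type*} [Monoid M] (m : M) (r : ℤ) :
    MonoidAlgebra.single m r = r • MonoidAlgebra.of ℤ M m := by
  simp

section Lift

variable {A : Type*} [AddCommGroup A] (φ : IsoClass G → A)
  (hφ : ∀ X Y, φ (isoClass (sum X Y)) = φ (isoClass X) + φ (isoClass Y))

/-- The additive extension of a function on isomorphism classes. -/
noncomputable def preLift : MonoidAlgebra ℤ (IsoClass G) →+ A :=
  (Finsupp.liftAddHom fun m => (zmultiplesHom A) (φ m)).comp
    MonoidAlgebra.coeffAddEquiv.toAddMonoidHom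

theorem preLift_of (m : IsoClass G) : preLift φ (MonoidAlgebra.of ℤ _ m) = φ m := by
  simp [preLift]

include hφ in
theorem preLift_eq_zero {x : MonoidAlgebra ℤ (IsoClass G)} (hx : x ∈ burnsideIdeal G) :
    preLift φ x = 0 := by
  -- `preLift` is only additive, so the induction over the ideal must carry all multiples. By
  -- distributivity, Z times a relation for X and Y is the relation for Z × X and Z × Y.
  suffices ∀ a, preLift φ (a * x) = 0 by simpa using this 1
  induction hx using Submodule.span_induction with
  | zero => simp
  | add x y _ _ hx hy => intro a; rw [mul_add, map_add, hx, hy, add_zero]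
  | smul b x _ hx => intro a; rw [smul_eq_mul, ← mul_assoc, hx]
  | mem x hx =>
    obtain ⟨X, Y, rfl⟩ := hx
    intro a
    induction a using MonoidAlgebra.induction_linear with
    | zero => simp
    | add a b ha hb => rw [add_mul, map_add, ha, hb, add_zero]
    | single m r =>
      obtain ⟨Z, rfl⟩ : ∃ Z, isoClass Z = m := Quotient.exists_rep m
      have hd : ∀ Z X : FiniteGSet G, isoClass Z * isoClass X = isoClass (prod Z X) :=
        fun _ _ => rfl
      have hs : isoClass (prod Z (sum X Y)) = isoClass (sum (prod Z X) (prod Z Y)) :=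
        Quotient.sound ⟨Equiv.prodSumDistrib _ _ _, by rintro g ⟨z, x | y⟩ <;> rfl⟩
      rw [single_eq_smul_of, smul_mul_assoc, map_zsmul, mul_sub, mul_sub, ← map_mul, ← map_mul,
        ← map_mul, hd, hd, hd, hs, map_sub, map_sub, preLift_of, preLift_of, preLift_of, hφ,
        add_sub_cancel_left, sub_self, smul_zero]

/-- An additive invariant of finite `G`-sets extends to the Burnside ring. -/
noncomputable def lift : BurnsideRing G →+ A :=
  QuotientAddGroup.lift _ (preLift φ) fun _ hx => preLift_eq_zero φ hφ hx

theorem lift_mk (X : FiniteGSet G) : lift φ hφ (mk X) = φ (isoClass X) := preLift_of φ _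

end Lift

/-- For empty X, X ⊔ X ≅ X, so [X] + [X] = [X]. -/
theorem mk_eq_zero_of_isEmpty (X : FiniteGSet G) [IsEmpty X.carrier] : mk X = 0 := by
  have : IsEmpty (sum X X).carrier := inferInstanceAs (IsEmpty (X.carrier ⊕ X.carrier))
  have h1 : mk (sum X X) = mk X := mk_eq_of_iso ⟨Equiv.equivOfIsEmpty _ _, fun _ x => isEmptyElim x⟩
  rw [mk_sum] at h1
  exact add_eq_left.1 h1

/-- The disjoint union of a finite family of finite `G`-sets. -/
def sigma {ι : Type v} [Finite ι] (A : ι → FiniteGSet G) : FiniteGSet G := ⟨Σ j, (A j).carrier⟩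

theorem mk_sigma_mem (S : AddSubgroup (BurnsideRing G)) {ι : Type v} [hι : Finite ι]
    (A : ι → FiniteGSet G) (hA : ∀ j, mk (A j) ∈ S) : mk (sigma A) ∈ S := by
  revert hι A
  suffices ∀ (hι : Finite ι) (A : ι → FiniteGSet G), (∀ j, mk (A j) ∈ S) → mk (sigma A) ∈ S from
    fun {hι} => this hι
  intro hι
  refine Finite.induction_empty_option (P := fun ι => ∀ (hι : Finite ι) (A : ι → FiniteGSet G),
    (∀ j, mk (A j) ∈ S) → mk (sigma A) ∈ S) ?_ ?_ ?_ ι hι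
  · intro α β e ih hβ A hA
    have := Finite.of_equiv _ e.symm
    have := ih this (fun a => A (e a)) fun a => hA _
    rwa [mk_eq_of_iso (Y := sigma A)
      ⟨Equiv.sigmaCongrLeft (β := fun j => (A j).carrier) e, fun _ _ => rfl⟩] at this
  · intro _ A _
    have : IsEmpty (sigma A).carrier := ⟨fun x => x.1.elim⟩
    rw [mk_eq_zero_of_isEmpty]
    exact S.zero_mem
  · intro α _ ih _ A hA
    let e : (Σ j, (A j).carrier) ≃ (A none).carrier ⊕ Σ j, (A (some j)).carrier :=
      { toFun := fun x => match x with
          | ⟨none, x⟩ => Sum.inl x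
          | ⟨some j, x⟩ => Sum.inr ⟨j, x⟩
        invFun := Sum.elim (fun x => ⟨none, x⟩) fun x => ⟨some x.1, x.2⟩
        left_inv := by rintro ⟨_ | j, x⟩ <;> rfl
        right_inv := by rintro (x | ⟨j, x⟩) <;> rfl }
    rw [mk_eq_of_iso (Y := sum (A none) (sigma fun j => A (some j)))
      ⟨e, by rintro g ⟨_ | j, x⟩ <;> rfl⟩, mk_sum]
    exact S.add_mem (hA _) (ih _ _ fun j => hA _)

/-- The orbit decomposition shows that transitive G-sets generate the Burnside ring additively. -/
theorem eq_top_of_mk_coset_mem [Finite G] (S : AddSubgroup (BurnsideRing G))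
    (hS : ∀ W, mk (coset W) ∈ S) : S = ⊤ := by
  have h : ∀ X, mk X ∈ S := by
    intro X
    obtain ⟨e, he⟩ := CohMackeyFunctor.exists_equiv_sigma_quotient_stabilizer (G := G) X.carrier
    rw [mk_eq_of_iso (Y := sigma fun o : MulAction.orbitRel.Quotient G X.carrier =>
      coset (MulAction.stabilizer G o.out)) ⟨e, he⟩]
    exact mk_sigma_mem S _ fun o => hS _
  refine (AddSubgroup.eq_top_iff' S).2 fun x => ?_
  obtain ⟨x, rfl⟩ := Ideal.Quotient.mk_surjective x
  induction x using MonoidAlgebra.induction_linear with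
  | zero => rw [map_zero]; exact S.zero_mem
  | add x y hx hy => rw [map_add]; exact S.add_mem hx hy
  | single m r =>
    obtain ⟨X, rfl⟩ : ∃ X, isoClass X = m := Quotient.exists_rep m
    rw [single_eq_smul_of, map_zsmul]
    exact S.zsmul_mem (h X) r

end BurnsideRing

namespace CohMackeyFunctor

variable {R : Type u} [CommRing R] {G : Type v} [Group G]

/-! ### Ranks of the values -/

section Rank

theorem finrank_eq_add_of_isShortExact [IsDomain R] {X Y Z : CohMackeyFunctor.{u, v, w} R G}
    {f : X ⟶ Y} {g : Y ⟶ Z} (h : IsShortExact f g) (hY : Y.IsLattice) (U : Subgroup G) :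
    Module.finrank R (Y.obj U) = Module.finrank R (X.obj U) + Module.finrank R (Z.obj U) := by
  obtain ⟨hf, hfg, hg⟩ := h U
  have := (hY U).1
  have h1 := Submodule.finrank_quotient_add_finrank (LinearMap.ker (Hom.app g U))
  rw [((Hom.app g U).quotKerEquivOfSurjective hg).finrank_eq, hfg.linearMap_ker_eq,
    LinearMap.finrank_range_of_inj hf] at h1
  rw [← h1, add_comm]

variable [Finite G] [IsMulCommutative G]

theorem stdCoeff_eq_of_mem {U W : Subgroup G} {g k : G} (h : g⁻¹ * k ∈ U)
    (f : (standardProjective R W).obj U) :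
    stdCoeff (k : G ⧸ W) f = stdCoeff (g : G ⧸ W) f := by
  have h2 := permCoeff_smul h (g : G ⧸ W) f
  rw [MulAction.Quotient.smul_coe, smul_eq_mul, mul_comm' _ g, mul_inv_cancel_left] at h2
  exact h2

/-- Coefficients at representatives of G/U are coordinates, and the coset indicators form the dual
basis. -/
theorem finrank_standardProjective_of_ge [Nontrivial R] {U W : Subgroup G} (h : W ≤ U) :
    Module.finrank R ((standardProjective R W).obj U) = U.index := by
  classical
  have := Fintype.ofFinite (G ⧸ U)
  let φ : (standardProjective R W).obj U →ₗ[R] (G ⧸ U → R) :=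
    LinearMap.pi fun c => stdCoeff ((c.out : G) : G ⧸ W)
  have hφ : Function.Bijective φ := by
    constructor
    · intro x y hxy
      refine stdCoeff_ext fun k => ?_
      have h1 : (k : G ⧸ U).out⁻¹ * k ∈ U := QuotientGroup.eq.1 (QuotientGroup.out_eq' _)
      rw [stdCoeff_eq_of_mem h1, stdCoeff_eq_of_mem h1]
      exact congrFun hxy k
    · intro a
      refine ⟨∑ c : G ⧸ U, a c • (standardProjective R W).tr h
        ((standardProjective R W).act c.out W (gen R W)), funext fun c => ?_⟩
      rw [LinearMap.pi_apply, map_sum, Fintype.sum_eq_single c]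
      · rw [map_smul, stdCoeff_tr_act_gen, if_pos (by simp), smul_eq_mul, mul_one]
      · intro d hd
        rw [map_smul, stdCoeff_tr_act_gen, if_neg, smul_zero]
        intro h'
        have := QuotientGroup.eq.2 h'
        rw [QuotientGroup.out_eq', QuotientGroup.out_eq'] at this
        exact hd this
  rw [(LinearEquiv.ofBijective φ hφ).finrank_eq, Module.finrank_fintype_fun_eq_card,
    Fintype.card_eq_nat_card, Subgroup.index]

theorem finrank_standardProjective_of_le [Nontrivial R] {U W : Subgroup G} (h : U ≤ W) :
    Module.finrank R ((standardProjective R W).obj U) = W.index := by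
  rw [← finrank_standardProjective_of_ge (R := R) (le_refl W),
    (LinearEquiv.ofBijective _ (res_bijective (R := R) h)).finrank_eq]

end Rank

/-! ### The Grothendieck group and its rank homomorphism -/

namespace K0

theorem mk_eq_add {X Y Z : ProjectiveLattice.{u, v} R G} {f : X.functor ⟶ Y.functor}
    {g : Y.functor ⟶ Z.functor} (h : IsShortExact f g) : mk Y = mk X + mk Z := by
  rw [← sub_eq_zero, ← sub_sub]
  exact (QuotientAddGroup.eq_zero_iff _).2 (AddSubgroup.subset_closure ⟨X, Y, Z, f, g, h, rfl⟩)

/-- A zero functor is all three terms of a short exact sequence, so [Z] = [Z] + [Z]. -/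
theorem mk_eq_zero_of_subsingleton (Z : ProjectiveLattice.{u, v} R G)
    (hZ : ∀ U, Subsingleton (Z.functor.obj U)) : mk Z = 0 := by
  have : IsShortExact (𝟙 Z.functor) (𝟙 Z.functor) := fun U => by
    have := hZ U
    exact ⟨fun _ _ h => h, fun _ => ⟨fun _ => ⟨0, Subsingleton.elim _ _⟩, fun _ =>
      Subsingleton.elim _ _⟩, fun x => ⟨x, rfl⟩⟩
  exact left_eq_add.1 (mk_eq_add this)

/-- An isomorphism becomes a relation once a zero functor serves as third term; the permutation
functor of the empty G-set will be that `Z`. -/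
theorem mk_eq_of_iso {X Y : ProjectiveLattice.{u, v} R G} (e : X.functor ≅ Y.functor)
    (Z : ProjectiveLattice.{u, v} R G) (hZ : ∀ U, Subsingleton (Z.functor.obj U)) :
    mk X = mk Y := by
  have h0 : IsShortExact e.hom
      ({ app := fun U => 0
         app_res := fun _ _ => by simp
         app_tr := fun _ _ => by simp
         app_cj := fun _ _ _ _ _ => by simp } : Y.functor ⟶ Z.functor) := fun U => by
    have := hZ U
    have h1 := congr_app e.hom_inv_id U
    have h2 := congr_app e.inv_hom_id U
    exact ⟨Function.LeftInverse.injective h1, fun y => ⟨fun _ => ⟨_, h2 y⟩, fun _ =>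
      Subsingleton.elim _ _⟩, fun x => ⟨0, Subsingleton.elim _ _⟩⟩
  rw [mk_eq_add h0, mk_eq_zero_of_subsingleton Z hZ, add_zero]

theorem eq_top_of_mk_mem (S : AddSubgroup (K0.{u, v} R G)) (hS : ∀ P, mk P ∈ S) : S = ⊤ := by
  refine (AddSubgroup.eq_top_iff' S).2 fun x => ?_
  obtain ⟨x, rfl⟩ := QuotientAddGroup.mk_surjective x
  induction x using FreeAbelianGroup.induction_on with
  | zero => exact S.zero_mem
  | of P => exact hS P
  | neg P hP => exact S.neg_mem hP
  | add x y hx hy => exact S.add_mem hx hy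

variable (R G) in
/-- The ranks of the values of projective lattice functors. -/
noncomputable def rank [IsDomain R] : K0.{u, v} R G →+ (Subgroup G → ℤ) :=
  QuotientAddGroup.lift _
    (FreeAbelianGroup.lift fun P U => (Module.finrank R (P.functor.obj U) : ℤ)) fun x hx => by
    refine (AddSubgroup.closure_le (AddMonoidHom.ker _)).2 ?_ hx
    rintro _ ⟨X, Y, Z, f, g, h, rfl⟩
    refine funext fun U => ?_
    simp [finrank_eq_add_of_isShortExact h Y.isLattice U]

theorem rank_mk [IsDomain R] (P : ProjectiveLattice.{u, v} R G) (U : Subgroup G) :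
    rank R G (mk P) U = Module.finrank R (P.functor.obj U) :=
  congrFun (FreeAbelianGroup.lift_apply_of _ P) U

end K0

/-! ### Comparison of the Burnside ring with K₀ -/

section Burnside

open FiniteGSet

variable [Finite G] (h1 : ∀ Ω : FiniteGSet G, Projective (permutation R (G := G) Ω.carrier))
  (h2 : ∀ Ω : FiniteGSet G, (permutation R (G := G) Ω.carrier).IsLattice)

theorem subsingleton_permutation_obj (A : Type v) [MulAction G A] [IsEmpty A] (U : Subgroup G) :
    Subsingleton ((permutation R (G := G) A).obj U) :=
  ⟨fun _ _ => permCoeff_ext fun a => isEmptyElim a⟩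

include h1 h2 in
theorem K0.mk_congr {X Y : ProjectiveLattice.{u, v} R G}
    (e : X.functor ≅ Y.functor) : K0.mk X = K0.mk Y := by
  have : IsEmpty (BurnsideRing.sigma (G := G) fun j : PEmpty => j.elim).carrier :=
    ⟨fun x => x.1.elim⟩
  exact K0.mk_eq_of_iso e ⟨_, h1 (BurnsideRing.sigma fun j : PEmpty => j.elim), h2 _⟩
    (subsingleton_permutation_obj _)

/-- The class `[h⁰(R[Ω])]` as a function of the isomorphism class of `Ω`. -/
noncomputable def permutationClass : IsoClass G → K0.{u, v} R G :=
  Quotient.lift (fun Ω => K0.mk ⟨permutation R Ω.carrier, h1 Ω, h2 Ω⟩) fun _ _ h =>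
    K0.mk_congr h1 h2 (permutationCongr R h.choose h.choose_spec)

theorem permutationClass_sum (X Y : FiniteGSet G) :
    permutationClass h1 h2 (isoClass (sum X Y)) =
      permutationClass h1 h2 (isoClass X) + permutationClass h1 h2 (isoClass Y) := by
  obtain ⟨f, g, h⟩ := exists_isShortExact_permutation_sum R (G := G) X.carrier Y.carrier
  exact K0.mk_eq_add (X := ⟨_, h1 X, h2 X⟩) (Y := ⟨_, h1 (sum X Y), h2 (sum X Y)⟩)
    (Z := ⟨_, h1 Y, h2 Y⟩) h

/-- The homomorphism from the Burnside ring to the Grothendieck group of projective lattice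
functors. -/
noncomputable def burnsideToK0 : BurnsideRing G →+ K0.{u, v} R G :=
  BurnsideRing.lift (permutationClass h1 h2) (permutationClass_sum h1 h2)

theorem burnsideToK0_mk (Ω : FiniteGSet G) : burnsideToK0 h1 h2 (BurnsideRing.mk Ω) =
    K0.mk ⟨permutation R Ω.carrier, h1 Ω, h2 Ω⟩ :=
  BurnsideRing.lift_mk _ _ Ω

/-- A sum of standard projectives is the permutation functor of a disjoint union of cosets. -/
theorem burnsideToK0_surjective
    (h : ∀ P : CohMackeyFunctor.{u, v, max u v} R G, Projective P → P.IsLattice →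
      ∃ f : Subgroup G → ℕ, Nonempty (P ≅ standardSum R f)) :
    Function.Surjective (burnsideToK0 h1 h2) := by
  rw [← AddMonoidHom.range_eq_top]
  refine K0.eq_top_of_mk_mem _ fun P => ?_
  obtain ⟨f, ⟨e⟩⟩ := h P.functor P.projective P.isLattice
  refine ⟨BurnsideRing.mk (BurnsideRing.sigma fun j : (Σ W : Subgroup G, Fin (f W)) =>
    coset j.1), ?_⟩
  rw [burnsideToK0_mk]
  exact K0.mk_congr h1 h2 (e ≪≫
    permutationSigma R fun j : (Σ W : Subgroup G, Fin (f W)) => G ⧸ j.1).symm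

variable {n : ℕ} (H : Fin (n + 1) ≃ Subgroup G)

/-- The homomorphism from the free abelian group on the transitive `G`-sets to the Burnside
ring. -/
noncomputable def freeToBurnside : (Fin (n + 1) → ℤ) →+ BurnsideRing G :=
  ∑ j, ((zmultiplesHom _) (BurnsideRing.mk (coset (H j)))).comp (Pi.evalAddMonoidHom _ j)

theorem freeToBurnside_apply (a : Fin (n + 1) → ℤ) :
    freeToBurnside H a = ∑ j, a j • BurnsideRing.mk (coset (H j)) := by
  simp [freeToBurnside, AddMonoidHom.finsetSum_apply]

theorem freeToBurnside_surjective : Function.Surjective (freeToBurnside H) := by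
  rw [← AddMonoidHom.range_eq_top]
  refine BurnsideRing.eq_top_of_mk_coset_mem _ fun W => ?_
  obtain ⟨j, rfl⟩ := H.surjective W
  refine ⟨Pi.single j 1, ?_⟩
  rw [freeToBurnside_apply, Fintype.sum_eq_single j, Pi.single_eq_same, one_smul]
  intro k hk
  rw [Pi.single_eq_of_ne hk, zero_smul]

variable [IsDomain R] [IsMulCommutative G] {H} {p : ℕ} (hp : p.Prime)
  (hH : ∀ i j, i ≤ j → H j ≤ H i) (hHi : ∀ i, (H i).index = p ^ (i : ℕ))

include hp hH hHi

/-- Ranks at the subgroups `H i` give a linear system in `a` with matrix p^min(i,j). -/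
theorem eq_zero_of_burnsideToK0_freeToBurnside {a : Fin (n + 1) → ℤ}
    (ha : burnsideToK0 h1 h2 (freeToBurnside H a) = 0) : a = 0 := by
  refine eq_zero_of_sum_mul_min (f := fun k => (p : ℤ) ^ k)
    (pow_right_strictMono₀ (by exact_mod_cast hp.one_lt)) (by simp) n a fun i => ?_
  have h3 : K0.rank R G (burnsideToK0 h1 h2 (freeToBurnside H a)) (H i) = 0 := by
    rw [ha, map_zero]
    rfl
  rw [freeToBurnside_apply, map_sum, map_sum, Finset.sum_apply] at h3
  rw [← h3]
  refine Finset.sum_congr rfl fun j _ => ?_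
  rw [map_zsmul, map_zsmul, Pi.smul_apply, burnsideToK0_mk, K0.rank_mk, smul_eq_mul]
  have h4 : Module.finrank R ((standardProjective R (H j)).obj (H i)) =
      p ^ min (i : ℕ) (j : ℕ) := by
    obtain hij | hij := le_total i j
    · rw [finrank_standardProjective_of_ge (hH _ _ hij), hHi, min_eq_left (Fin.le_def.1 hij)]
    · rw [finrank_standardProjective_of_le (hH _ _ hij), hHi, min_eq_right (Fin.le_def.1 hij)]
  refine congrArg (a j * ·) ?_
  exact_mod_cast h4.symm

theorem burnsideToK0_injective : Function.Injective (burnsideToK0 h1 h2) := by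
  refine (injective_iff_map_eq_zero _).2 fun b hb => ?_
  obtain ⟨a, rfl⟩ := freeToBurnside_surjective H b
  rw [eq_zero_of_burnsideToK0_freeToBurnside h1 h2 hp hH hHi hb, map_zero]

-- Independence of the [G/W] is read off from their images in K₀.
include h1 h2 in
theorem freeToBurnside_bijective : Function.Bijective (freeToBurnside H) :=
  ⟨(injective_iff_map_eq_zero _).2 fun a ha =>
    eq_zero_of_burnsideToK0_freeToBurnside h1 h2 hp hH hHi (by rw [ha, map_zero]),
    freeToBurnside_surjective H⟩

end Burnside

end CohMackeyFunctor

theorem mainTheorem9 {R : Type u} [CommRing R] [IsDomain R] [IsDiscreteValuationRing R] [CharZero R]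
    {p : ℕ} (hp : p.Prime) (hR : IsLocalRing.maximalIdeal R = Ideal.span {(p : R)})
    {G : Type v} [Group G] [Finite G] [IsCyclic G] {n : ℕ} (hG : Nat.card G = p ^ n) :
    (∀ P : CohMackeyFunctor.{u, v, max u v} R G, Projective P → P.IsLattice →
      ∃ f : Subgroup G → ℕ, Nonempty (P ≅ CohMackeyFunctor.directSum
        (fun j : (Σ W : Subgroup G, Fin (f W)) =>
          CohMackeyFunctor.standardProjective R j.1))) ∧
    (∃ (h1 : ∀ Ω : FiniteGSet G, Projective (CohMackeyFunctor.permutation R Ω.carrier))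
      (h2 : ∀ Ω : FiniteGSet G, (CohMackeyFunctor.permutation R Ω.carrier).IsLattice)
      (e : BurnsideRing G ≃+ CohMackeyFunctor.K0 R G),
      ∀ Ω : FiniteGSet G, e (BurnsideRing.mk Ω) =
        CohMackeyFunctor.K0.mk ⟨CohMackeyFunctor.permutation R Ω.carrier, h1 Ω, h2 Ω⟩) ∧
    Nonempty (BurnsideRing G ≃+ (Fin (n + 1) → ℤ)) := by
  have hcomm : IsMulCommutative G := inferInstance
  have hpR : (p : R) ∈ IsLocalRing.maximalIdeal R := hR ▸ Ideal.mem_span_singleton_self _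
  obtain ⟨H, hH, hHi⟩ := IsCyclic.exists_equiv_subgroup hp hG
  have hc : ∀ U V : Subgroup G, U ≤ V ∨ V ≤ U := by
    intro U V
    obtain ⟨i, rfl⟩ := H.surjective U
    obtain ⟨j, rfl⟩ := H.surjective V
    exact (le_total j i).imp (hH _ _) (hH _ _)
  obtain ⟨g₀, hg₀⟩ := IsCyclic.exists_monoid_generator (α := G)
  have h1 : ∀ Ω : FiniteGSet G, Projective (CohMackeyFunctor.permutation R (G := G) Ω.carrier) :=
    fun Ω => CohMackeyFunctor.projective_permutation hc Ω.carrier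
  have h2 : ∀ Ω : FiniteGSet G, (CohMackeyFunctor.permutation R (G := G) Ω.carrier).IsLattice :=
    fun Ω => CohMackeyFunctor.isLattice_permutation Ω.carrier
  have h3 := fun P hP hL =>
    CohMackeyFunctor.exists_iso_standardSum (R := R) hp hpR hG hc hg₀ P hP hL
  exact ⟨h3, ⟨h1, h2, AddEquiv.ofBijective (CohMackeyFunctor.burnsideToK0 h1 h2)
    ⟨CohMackeyFunctor.burnsideToK0_injective h1 h2 hp hH hHi,
      CohMackeyFunctor.burnsideToK0_surjective h1 h2 h3⟩,
    CohMackeyFunctor.burnsideToK0_mk h1 h2⟩,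
    ⟨(AddEquiv.ofBijective _
      (CohMackeyFunctor.freeToBurnside_bijective h1 h2 hp hH hHi)).symm⟩⟩
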